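/- A rooted planar map is a connected planar graph (loops and multiple edges allowed) properly embedded in the oriented sphere, with one edge oriented (the root-edge), considered up to orientation-preserving homeomorphism; the atomic map, with one vertex and no edge, is included. The root-face is the face to the right of the root-edge, and it has degree $0$ for the atomic map. A near-triangulation is a rooted planar map in which every face other than the root-face has degree $3$. A tree-rooted near-triangulation is a near-triangulation with a distinguished spanning tree. For integers $i,d\ge 0$, let $N(i,d)$ be the number of tree-rooted near-triangulations having $i+1$ vertices and a root-face of degree $d$. This number is finite, and for $i\ge 1$ and $0\le d\le 2i$, $$ N(i,d)=\frac{d}{(i+1)(4i-d)}\binom{3i-d}{i}\binom{4i-d}{i}. $$ Moreover $N(i,d)=0$ for $d>2i$, and $N(0,0)=1$ (the atomic map). The associated generating function is D-finite, whether one counts by non-root vertices and root-face degree, or by edges and root-face degree. That is, let $$ F(x,y)=\sum_{i,d\ge 0} N(i,d)\,x^i y^d ,\qquad G(t,y)=\sum_{n,d\ge 0} E(n,d)\,t^n y^d , $$ where $E(n,d)$ is the (finite) number of tree-rooted near-triangulations with $n$ edges and root-face degree $d$. Then, with respect to each of its two variables, each of $F$ and $G$ satisfies a non-trivial linear differential equation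 whose coefficients are polynomials over $\mathbb Q$ in both variables. -/

import Mathlib

/-- A finite connected multigraph (loops and multiple edges allowed) embedded in an oriented
surface, encoded as a rotation system. Every edge is split into two opposite darts (oriented
edges), exchanged by the fixed-point-free involution `flip`, and `origin` sends a dart to its
initial vertex. The permutation `rot` sends a dart to the next one in counterclockwise order
around its origin, so that its cycles are the stars of the vertices. A vertex without darts is
allowed; by connectedness it is then the only vertex and there is no edge. -/
structure EmbeddedGraph where
  Vertex : Type
  Dart : Type
  finite_vertex : Finite Vertex
  finite_dart : Finite Dart
  origin : Dart → Vertex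
  flip : Equiv.Perm Dart
  rot : Equiv.Perm Dart
  flip_flip : ∀ a, flip (flip a) = a
  flip_ne : ∀ a, flip a ≠ a
  origin_eq_iff : ∀ a b, origin a = origin b ↔ rot.SameCycle a b
  connected : (SimpleGraph.fromRel fun u v : Vertex =>
    ∃ a, origin a = u ∧ origin (flip a) = v).Connected

namespace EmbeddedGraph

variable (M : EmbeddedGraph)

/-- With counterclockwise rotations, the dart that follows `a` along the boundary of the face
lying to the right of `a` is `rot (flip a)`. -/
def facePerm : Equiv.Perm M.Dart := M.rot * M.flip

/-- The degree of the face lying to the right of `a`: the number of darts having this face on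
their right, that is, the number of edges incident to the face, counted with multiplicity. -/
noncomputable def faceDegree (a : M.Dart) : ℕ :=
  Nat.card {b : M.Dart // M.facePerm.SameCycle a b}

noncomputable def numVertices : ℕ := Nat.card M.Vertex

/-- Each edge consists of exactly two darts. -/
noncomputable def numEdges : ℕ := Nat.card M.Dart / 2

open Classical in
/-- The faces are the cycles of `facePerm`, except that a map without edges has one face. -/
noncomputable def numFaces : ℕ :=
  if IsEmpty M.Dart then 1 else Nat.card (Quotient (Equiv.Perm.SameCycle.setoid M.facePerm))

/-- Adjacency of distinct vertices through an edge whose darts belong to `S`. -/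
def subgraph (S : Set M.Dart) : SimpleGraph M.Vertex :=
  SimpleGraph.fromRel fun u v => ∃ a ∈ S, M.origin a = u ∧ M.origin (M.flip a) = v

/-- The set of edges whose darts form the set `S` is a spanning tree: `S` consists of whole
edges, has no loop and no pair of parallel edges, and its edges form a tree on the set of
all vertices. -/
structure IsSpanningTree (S : Set M.Dart) : Prop where
  flip_mem : ∀ a ∈ S, M.flip a ∈ S
  no_loop : ∀ a ∈ S, M.origin a ≠ M.origin (M.flip a)
  no_parallel : ∀ a ∈ S, ∀ b ∈ S, M.origin a = M.origin b →
    M.origin (M.flip a) = M.origin (M.flip b) → a = b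
  isTree : (M.subgraph S).IsTree

end EmbeddedGraph

/-- A rooted planar map: the surface is the sphere (Euler's relation), and one edge is oriented,
that is, one dart is chosen as the root-edge. Only the atomic map, which has one vertex and no
edge, has no root dart. -/
structure RootedPlanarMap extends EmbeddedGraph where
  euler : toEmbeddedGraph.numVertices + toEmbeddedGraph.numFaces = toEmbeddedGraph.numEdges + 2
  root : Option Dart
  root_eq_none : root = none → IsEmpty Dart

namespace RootedPlanarMap

variable (M : RootedPlanarMap)

/-- The degree of the root-face, which is the face to the right of the root-edge. It is `0` for
the atomic map. -/
noncomputable def outerDegree : ℕ :=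
  match M.root with
  | none => 0
  | some r => M.faceDegree r

/-- Every face other than the root-face has degree 3. -/
def IsNearTriangulation : Prop :=
  ∀ r, M.root = some r → ∀ a : M.Dart, ¬ M.facePerm.SameCycle r a → M.faceDegree a = 3

end RootedPlanarMap

/-- A concrete near-triangulation with a distinguished spanning tree, before identification of
isomorphic ones. -/
structure TreeRootedRep extends RootedPlanarMap where
  isNearTriangulation : toRootedPlanarMap.IsNearTriangulation
  tree : Set Dart
  isSpanningTree : toEmbeddedGraph.IsSpanningTree tree

namespace TreeRootedRep

/-- Orientation-preserving isomorphisms that preserve the root and the tree. -/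
structure Iso (M N : TreeRootedRep) where
  vertexEquiv : M.Vertex ≃ N.Vertex
  dartEquiv : M.Dart ≃ N.Dart
  map_origin : ∀ a, N.origin (dartEquiv a) = vertexEquiv (M.origin a)
  map_flip : ∀ a, N.flip (dartEquiv a) = dartEquiv (M.flip a)
  map_rot : ∀ a, N.rot (dartEquiv a) = dartEquiv (M.rot a)
  map_root : N.root = M.root.map dartEquiv
  map_tree : ∀ a, dartEquiv a ∈ N.tree ↔ a ∈ M.tree

def Iso.refl (M : TreeRootedRep) : Iso M M where
  vertexEquiv := Equiv.refl _
  dartEquiv := Equiv.refl _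
  map_origin _ := rfl
  map_flip _ := rfl
  map_rot _ := rfl
  map_root := by simp
  map_tree _ := Iff.rfl

def Iso.symm {M N : TreeRootedRep} (f : Iso M N) : Iso N M where
  vertexEquiv := f.vertexEquiv.symm
  dartEquiv := f.dartEquiv.symm
  map_origin a := by
    rw [Equiv.eq_symm_apply, ← f.map_origin, Equiv.apply_symm_apply]
  map_flip a := by
    rw [Equiv.eq_symm_apply, ← f.map_flip, Equiv.apply_symm_apply]
  map_rot a := by
    rw [Equiv.eq_symm_apply, ← f.map_rot, Equiv.apply_symm_apply]
  map_root := by simp [f.map_root, Function.comp_def]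
  map_tree a := by rw [← f.map_tree, Equiv.apply_symm_apply]

def Iso.trans {M N P : TreeRootedRep} (f : Iso M N) (g : Iso N P) : Iso M P where
  vertexEquiv := f.vertexEquiv.trans g.vertexEquiv
  dartEquiv := f.dartEquiv.trans g.dartEquiv
  map_origin a := by simp [f.map_origin, g.map_origin]
  map_flip a := by simp [f.map_flip, g.map_flip]
  map_rot a := by simp [f.map_rot, g.map_rot]
  map_root := by simp [f.map_root, g.map_root, Function.comp_def]
  map_tree a := by simp [f.map_tree, g.map_tree]

instance setoid : Setoid TreeRootedRep where
  r M N := Nonempty (Iso M N)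
  iseqv :=
    { refl := fun M => ⟨Iso.refl M⟩
      symm := fun ⟨f⟩ => ⟨f.symm⟩
      trans := fun ⟨f⟩ ⟨g⟩ => ⟨f.trans g⟩ }

theorem Iso.outerDegree_eq {M N : TreeRootedRep} (f : Iso M N) :
    M.outerDegree = N.outerDegree := by
  have hface : ∀ a, N.facePerm (f.dartEquiv a) = f.dartEquiv (M.facePerm a) := fun a => by
    simp [EmbeddedGraph.facePerm, f.map_flip, f.map_rot]
  have hconj : N.facePerm = f.dartEquiv.permCongr M.facePerm := by
    ext b
    rw [Equiv.permCongr_apply, ← hface, Equiv.apply_symm_apply]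
  have hzpow : ∀ (n : ℤ) (a : M.Dart),
      (N.facePerm ^ n) (f.dartEquiv a) = f.dartEquiv ((M.facePerm ^ n) a) := fun n a => by
    have h : N.facePerm ^ n = f.dartEquiv.permCongr (M.facePerm ^ n) := by
      rw [hconj]
      exact (map_zpow f.dartEquiv.permCongrHom M.facePerm n).symm
    rw [h, Equiv.permCongr_apply, Equiv.symm_apply_apply]
  unfold RootedPlanarMap.outerDegree
  rw [f.map_root]
  cases M.root with
  | none => rfl
  | some r =>
    refine Nat.card_congr (f.dartEquiv.subtypeEquiv fun a => ?_)
    exact exists_congr fun n => by rw [hzpow, f.dartEquiv.apply_eq_iff_eq]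

end TreeRootedRep

/-- Tree-rooted near-triangulations: near-triangulations (rooted planar maps whose non-root
faces all have degree 3) with a distinguished spanning tree, up to isomorphism. -/
def TreeRootedNearTriangulation : Type 1 := Quotient TreeRootedRep.setoid

namespace TreeRootedNearTriangulation

noncomputable def numVertices (T : TreeRootedNearTriangulation) : ℕ :=
  Quotient.lift (fun M : TreeRootedRep => M.numVertices)
    (by rintro _ _ ⟨f⟩; exact Nat.card_congr f.vertexEquiv) T

noncomputable def numEdges (T : TreeRootedNearTriangulation) : ℕ :=
  Quotient.lift (fun M : TreeRootedRep => M.numEdges)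
    (by rintro _ _ ⟨f⟩; exact congrArg (· / 2) (Nat.card_congr f.dartEquiv)) T

noncomputable def outerDegree (T : TreeRootedNearTriangulation) : ℕ :=
  Quotient.lift (fun M : TreeRootedRep => M.outerDegree) (by rintro _ _ ⟨f⟩; exact f.outerDegree_eq) T

/-- Those with `v` vertices and a root-face of degree `d`. -/
def WithVertices (v d : ℕ) : Type 1 :=
  {T : TreeRootedNearTriangulation // T.numVertices = v ∧ T.outerDegree = d}

/-- Those with `n` edges and a root-face of degree `d`. -/
def WithEdges (n d : ℕ) : Type 1 :=
  {T : TreeRootedNearTriangulation // T.numEdges = n ∧ T.outerDegree = d}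

/-- The generating function by non-root vertices (variable `0`) and root-face degree
(variable `1`). -/
noncomputable def vertexSeries : MvPowerSeries (Fin 2) ℚ :=
  fun m => (Nat.card (WithVertices (m 0 + 1) (m 1)) : ℚ)

/-- The generating function by edges (variable `0`) and root-face degree (variable `1`). -/
noncomputable def edgeSeries : MvPowerSeries (Fin 2) ℚ :=
  fun m => (Nat.card (WithEdges (m 0) (m 1)) : ℚ)

end TreeRootedNearTriangulation

/-- A power series in several variables is D-finite if, for each variable, it satisfies a
non-trivial linear differential equation in this variable with polynomial coefficients. -/
def IsDFinite {σ K : Type*} [Field K] (F : MvPowerSeries σ K) : Prop :=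
  ∀ k : σ, ∃ (r : ℕ) (p : Fin (r + 1) → MvPolynomial σ K), (∃ j, p j ≠ 0) ∧
    ∑ j, (p j : MvPowerSeries σ K) * (MvPowerSeries.pderiv K k)^[(j : ℕ)] F = 0

/-! Walking round the spanning tree visits every dart exactly once. Let `f` be this tour, a single
cycle on the darts, and let `a` and `b` be the involutions exchanging the two darts of each tree
edge and of each other edge. Then `rot = f * a`, `flip = a * b` and the face permutation is `f * b`,
so the triple and the root dart determine the map (`IsTreeCode`). A product `f * g` with an
involution `g` has at most `numMoved g / 2` cycles more than `f`. Equality (`Planar`) means that the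
pairs of `g` are noncrossing chords of the circle `f`. For `a` equality expresses that the tree
spans; for `b` it is Euler's relation. Numbering the darts along the tour from the root kills all
automorphisms, so isomorphism classes are pairs of noncrossing matchings of `Fin (n + 1)` with
complementary supports (`ofCode_injective`, `ofCode_surjective`).

The condition on the faces involves `b` alone: the cycle of the root has size `d` and all others
have size 3. Counting points and cycles gives `2i - d` chords on `6i - 2d` points. Deleting the
point `0`, with its chord if there is one, yields the recurrence of the ballot numbers `forestCount
d (2i - d)` (`countAdmissible_three`). For each such `b`, the tree is an arbitrary noncrossing
perfect matching of the `2i` points left over, which is a Catalan choice `forestCount 1 i`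
(`card_isPlanarMatching`). The product of the two numbers is the formula (`card_isTreeCode`,
`card_withVertices`).

For D-finiteness, the coefficients obey one hypergeometric recurrence in `d` and one in `i`.
Multiplying the coefficients by a polynomial in the exponents amounts to applying a polynomial in
the Euler operators. Each recurrence, multiplied by monomials, relates such weighted series modulo
weights of lower degree. The leading forms of the two recurrences have no common zero, so up to
torsion over the polynomial ring all weights reduce to those of degree at most 4
(`map_eq_zero_of_recurrence`). Hence all derivatives have nonzero polynomial multiples in one
finitely generated module, and enough of them are linearly dependent (`isDFinite_of_recurrence`). -/

open Equiv Equiv.Perm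

/-! ### Cycles of a permutation multiplied by a transposition. -/

namespace PermCycle

section Cycles

variable {X : Type*}

/-- The number of cycles of a permutation, fixed points included. -/
noncomputable def numCycles (f : Perm X) : ℕ := Nat.card (Quotient (SameCycle.setoid f))

/-- The number of elements of the cycle through `x`. -/
noncomputable def cycleSize (f : Perm X) (x : X) : ℕ := Nat.card {y // f.SameCycle x y}

theorem cycleSize_congr {f : Perm X} {x y : X} (h : f.SameCycle x y) :
    cycleSize f x = cycleSize f y :=
  Nat.card_congr (Equiv.subtypeEquivRight fun _ => ⟨h.symm.trans, h.trans⟩)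

variable [Finite X]

theorem mem_of_sameCycle {f : Perm X} {s : Set X} (hs : ∀ x ∈ s, f x ∈ s) {x y : X}
    (h : f.SameCycle x y) (hx : x ∈ s) : y ∈ s := by
  obtain ⟨n, rfl⟩ := h.exists_nat_pow_eq
  induction n with
  | zero => simpa
  | succ n ih =>
    rw [pow_succ', Perm.mul_apply]
    exact hs _ (ih ⟨n, by simp⟩)

theorem rel_of_sameCycle {f : Perm X} {r : X → X → Prop} (hr : Equivalence r)
    (h : ∀ x, r x (f x)) {x y : X} (hxy : f.SameCycle x y) : r x y :=
  mem_of_sameCycle (s := {z | r x z}) (fun z hz => hr.trans hz (h z)) hxy (hr.refl x)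

theorem cycleSize_pos (f : Perm X) (x : X) : 0 < cycleSize f x :=
  have : Nonempty {y // f.SameCycle x y} := ⟨⟨x, SameCycle.refl f x⟩⟩
  Nat.card_pos

variable [DecidableEq X]

theorem sameCycle_or_of_mul_swap {f : Perm X} {a b x y : X}
    (h : (f * swap a b).SameCycle x y) :
    f.SameCycle x y ∨ ((f.SameCycle a x ∨ f.SameCycle b x) ∧
      (f.SameCycle a y ∨ f.SameCycle b y)) := by
  refine rel_of_sameCycle (r := fun x y => f.SameCycle x y ∨
    ((f.SameCycle a x ∨ f.SameCycle b x) ∧ (f.SameCycle a y ∨ f.SameCycle b y)))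
    ⟨fun x => Or.inl (SameCycle.refl f x), ?_, ?_⟩ ?_ h
  · rintro x y (h | ⟨h, h'⟩)
    · exact Or.inl h.symm
    · exact Or.inr ⟨h', h⟩
  · rintro x y z (h | ⟨h, h'⟩) (k | ⟨k, k'⟩)
    · exact Or.inl (h.trans k)
    · exact Or.inr ⟨k.imp (·.trans h.symm) (·.trans h.symm), k'⟩
    · exact Or.inr ⟨h, h'.imp (·.trans k) (·.trans k)⟩
    · exact Or.inr ⟨h, k'⟩
  · intro x
    rw [Perm.mul_apply]
    by_cases hxa : x = a
    · subst hxa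
      right
      simp [sameCycle_apply_right, SameCycle.refl]
    · by_cases hxb : x = b
      · subst hxb
        right
        simp [sameCycle_apply_right, SameCycle.refl]
      · left
        rw [swap_apply_of_ne_of_ne hxa hxb, sameCycle_apply_right]

/-- The new permutation sends `a` to `f b` and then follows `f` inside the old cycle of `b`, which
avoids `a`; it must therefore come to `b`. -/
theorem sameCycle_mul_swap {f : Perm X} {a b : X} (h : ¬ f.SameCycle a b) :
    (f * swap a b).SameCycle a b := by
  by_contra h'
  refine h' (mem_of_sameCycle (f := f)
    (s := {x | f.SameCycle b x ∧ (f * swap a b).SameCycle a x}) ?_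
    (sameCycle_apply_left.2 (SameCycle.refl f b)) ⟨?_, ?_⟩).2
  · rintro x ⟨h1, h2⟩
    have hxa : x ≠ a := fun e => h (e ▸ h1.symm)
    have hxb : x ≠ b := fun e => h' (e ▸ h2)
    refine ⟨sameCycle_apply_right.2 h1, ?_⟩
    have : f x = (f * swap a b) x := by
      rw [Perm.mul_apply, swap_apply_of_ne_of_ne hxa hxb]
    rw [this]
    exact sameCycle_apply_right.2 h2
  · exact sameCycle_apply_right.2 (SameCycle.refl f b)
  · have : f b = (f * swap a b) a := by simp
    rw [this]
    exact sameCycle_apply_right.2 (SameCycle.refl _ a)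

/-- The arc `f a, f² a, ..., f^k a = b`, with `k` the first time that `b` is reached, is closed
under the new permutation, which sends `b` back to `f a`. This arc misses `a`. -/
theorem not_sameCycle_mul_swap {f : Perm X} {a b : X} (hab : a ≠ b) (h : f.SameCycle a b) :
    ¬ (f * swap a b).SameCycle a b := by
  classical
  have hex : ∃ k, (f ^ k) a = b := h.exists_nat_pow_eq
  have hk := Nat.find_spec hex
  have hmin : ∀ j < Nat.find hex, (f ^ j) a ≠ b := fun j hj => Nat.find_min hex hj
  set k := Nat.find hex
  have hk0 : 0 < k := by
    rcases Nat.eq_zero_or_pos k with h0 | h0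
    · rw [h0] at hk; exact absurd (by simpa using hk) hab
    · exact h0
  have hne : ∀ j, 1 ≤ j → j ≤ k → (f ^ j) a ≠ a := by
    intro j h1 h2 h3
    refine hmin (k - j) (by omega) ?_
    conv_lhs => rw [← h3]
    rw [← Perm.mul_apply, ← pow_add, Nat.sub_add_cancel h2, hk]
  intro h'
  obtain ⟨j, h1, h2, h3⟩ : a ∈ {x | ∃ j, 1 ≤ j ∧ j ≤ k ∧ (f ^ j) a = x} := by
    refine mem_of_sameCycle ?_ h'.symm ⟨k, hk0, le_rfl, hk⟩
    rintro _ ⟨j, h1, h2, rfl⟩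
    rcases h2.eq_or_lt with rfl | h2
    · exact ⟨1, le_rfl, hk0, by rw [hk]; simp⟩
    · refine ⟨j + 1, by omega, h2, ?_⟩
      rw [Perm.mul_apply, swap_apply_of_ne_of_ne (hne j h1 h2.le) (hmin j h2), pow_succ',
        Perm.mul_apply]
  exact hne j h1 h2 h3

theorem sameCycle_mul_swap_iff {f : Perm X} {a b : X} (h : ¬ f.SameCycle a b) {x y : X} :
    (f * swap a b).SameCycle x y ↔ f.SameCycle x y ∨
      ((f.SameCycle a x ∨ f.SameCycle b x) ∧ (f.SameCycle a y ∨ f.SameCycle b y)) := by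
  have hab := sameCycle_mul_swap h
  have key : ∀ {x y}, f.SameCycle x y → (f * swap a b).SameCycle x y := by
    intro x y hxy
    have : f = (f * swap a b) * swap a b := by simp [mul_assoc]
    rw [this] at hxy
    rcases sameCycle_or_of_mul_swap hxy with h1 | ⟨h1, h2⟩
    · exact h1
    · have h1 : (f * swap a b).SameCycle a x := h1.elim id hab.trans
      have h2 : (f * swap a b).SameCycle a y := h2.elim id hab.trans
      exact h1.symm.trans h2
  refine ⟨sameCycle_or_of_mul_swap, ?_⟩
  rintro (h1 | ⟨h1, h2⟩)
  · exact key h1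
  · have h1 : (f * swap a b).SameCycle a x := h1.elim key fun h => hab.trans (key h)
    have h2 : (f * swap a b).SameCycle a y := h2.elim key fun h => hab.trans (key h)
    exact h1.symm.trans h2

theorem numCycles_eq_mul_swap_add_one {f : Perm X} {a b : X} (h : ¬ f.SameCycle a b) :
    numCycles f = numCycles (f * swap a b) + 1 := by
  classical
  let s := SameCycle.setoid f
  let t := SameCycle.setoid (f * swap a b)
  have hst : ∀ x y : X, s x y → t x y := fun x y hxy => (sameCycle_mul_swap_iff h).2 (Or.inl hxy)
  have key : Nat.card {q : Quotient s // q ≠ ⟦b⟧} = Nat.card (Quotient t) := by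
    refine Nat.card_eq_of_bijective
      (fun q => Quotient.map' (s₁ := s) (s₂ := t) id hst q.1) ⟨?_, ?_⟩
    · rintro ⟨q, hq⟩ ⟨q', hq'⟩ hqq
      induction q using Quotient.inductionOn with | _ x
      induction q' using Quotient.inductionOn with | _ y
      have hx : ¬ f.SameCycle x b := fun e => hq (Quotient.sound e)
      have hy : ¬ f.SameCycle y b := fun e => hq' (Quotient.sound e)
      have hxy : (f * swap a b).SameCycle x y := Quotient.exact hqq
      refine Subtype.ext (Quotient.sound (?_ : f.SameCycle x y))
      rcases (sameCycle_mul_swap_iff h).1 hxy with h1 | ⟨h1, h2⟩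
      · exact h1
      · exact (h1.resolve_right fun e => hx e.symm).symm.trans
          (h2.resolve_right fun e => hy e.symm)
    · intro q
      induction q using Quotient.inductionOn with | _ y
      by_cases hy : f.SameCycle b y
      · exact ⟨⟨⟦a⟧, fun e => h (Quotient.exact e)⟩, Quotient.sound
          ((sameCycle_mul_swap_iff h).2 (Or.inr ⟨Or.inl (SameCycle.refl f a), Or.inr hy⟩))⟩
      · exact ⟨⟨⟦y⟧, fun e => hy (SameCycle.symm (Quotient.exact e))⟩, rfl⟩
  have : Finite (Quotient s) := inferInstance
  unfold numCycles
  have h2 := Nat.card_congr (Equiv.sumCompl (fun q : Quotient s => q = ⟦b⟧))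
  rw [Nat.card_sum] at h2
  have h3 : Nat.card {q : Quotient s // q = ⟦b⟧} = 1 := by simp
  have h4 : Nat.card {q : Quotient s // ¬ q = ⟦b⟧} = Nat.card (Quotient t) := key
  rw [h3, h4] at h2
  rw [← h2, add_comm]

theorem numCycles_mul_swap_eq_add_one {f : Perm X} {a b : X} (hab : a ≠ b)
    (h : f.SameCycle a b) : numCycles (f * swap a b) = numCycles f + 1 := by
  have := numCycles_eq_mul_swap_add_one (not_sameCycle_mul_swap hab h)
  rwa [mul_assoc, swap_mul_self, mul_one] at this

end Cycles

end PermCycle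

/-! ### Involutions and the genus bound. -/

namespace PermCycle

section Involutions

variable {X : Type*} [DecidableEq X]

/-- The number of elements that a permutation moves. -/
noncomputable def numMoved (g : Perm X) : ℕ := Nat.card {x // g x ≠ x}

/-- Turns `a` and its image under the involution `g` into fixed points. -/
def unpair (g : Perm X) (a : X) : Perm X := g * swap a (g a)

theorem unpair_mul_swap (g : Perm X) (a : X) : unpair g a * swap a (g a) = g := by
  simp [unpair, mul_assoc]

theorem mul_unpair_mul_swap (f g : Perm X) (a : X) : f * unpair g a * swap a (g a) = f * g := by
  rw [mul_assoc, unpair_mul_swap]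

theorem unpair_apply_of_ne {g : Perm X} {a x : X} (h : x ≠ a) (h' : x ≠ g a) :
    unpair g a x = g x := by
  rw [unpair, Perm.mul_apply, swap_apply_of_ne_of_ne h h']

theorem unpair_apply_self {g : Perm X} (hg : Function.Involutive g) (a : X) :
    unpair g a a = a := by
  simp [unpair, hg a]

theorem unpair_apply_image (g : Perm X) (a : X) : unpair g a (g a) = g a := by
  simp [unpair]

theorem unpair_eq_or {g : Perm X} (hg : Function.Involutive g) (a x : X) :
    unpair g a x = x ∨ unpair g a x = g x := by
  by_cases h : x = a
  · exact Or.inl (h ▸ unpair_apply_self hg a)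
  by_cases h' : x = g a
  · exact Or.inl (h' ▸ unpair_apply_image g a)
  · exact Or.inr (unpair_apply_of_ne h h')

theorem unpair_involutive {g : Perm X} (hg : Function.Involutive g) (a : X) :
    Function.Involutive (unpair g a) := by
  intro x
  by_cases h : x = a
  · rw [h, unpair_apply_self hg, unpair_apply_self hg]
  by_cases h' : x = g a
  · rw [h', unpair_apply_image, unpair_apply_image]
  · rw [unpair_apply_of_ne h h', unpair_apply_of_ne _ _, hg x]
    · exact fun e => h' (by rw [← e, hg])
    · exact fun e => h (g.injective e)

theorem unpair_apply_ne_iff {g : Perm X} (hg : Function.Involutive g) {a x : X} :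
    unpair g a x ≠ x ↔ g x ≠ x ∧ x ≠ a ∧ x ≠ g a := by
  by_cases h : x = a
  · simp [h, unpair_apply_self hg]
  by_cases h' : x = g a
  · simp [h', unpair_apply_image]
  · simp [unpair_apply_of_ne h h', h, h']

variable [Finite X]

theorem numMoved_eq_unpair_add_two {g : Perm X} (hg : Function.Involutive g) {a : X}
    (ha : g a ≠ a) : numMoved g = numMoved (unpair g a) + 2 := by
  have h1 : numMoved g = {x | g x ≠ x}.ncard := rfl
  have h2 : numMoved (unpair g a) = {x | unpair g a x ≠ x}.ncard := rfl
  have h3 : {x | g x ≠ x} = insert a (insert (g a) {x | unpair g a x ≠ x}) := by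
    ext x
    simp only [Set.mem_ofPred_eq, Set.mem_insert_iff, unpair_apply_ne_iff hg]
    by_cases h : x = a
    · simp [h, ha]
    · by_cases h' : x = g a
      · simp [h', hg a, ha.symm]
      · simp [h, h']
  rw [h1, h2, h3, Set.ncard_insert_of_notMem, Set.ncard_insert_of_notMem]
  · simp [unpair_apply_image]
  · simp [unpair_apply_self hg, ha.symm]

theorem numMoved_eq_zero_iff {g : Perm X} : numMoved g = 0 ↔ g = 1 := by
  rw [numMoved, Nat.card_eq_zero, or_iff_left (not_infinite_iff_finite.2 inferInstance),
    isEmpty_subtype]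
  simp [Equiv.ext_iff]

/-- Equality in the genus bound. -/
def Planar (f g : Perm X) : Prop := 2 * numCycles (f * g) = numMoved g + 2 * numCycles f

/-- The pairs of `g` are inserted one at a time; each is a transposition, and so creates at most one
new cycle. -/
theorem two_mul_numCycles_le (f : Perm X) {g : Perm X} (hg : Function.Involutive g) :
    2 * numCycles (f * g) ≤ numMoved g + 2 * numCycles f := by
  induction hn : numMoved g using Nat.strong_induction_on generalizing g with | _ n ih
  by_cases h1 : g = 1
  · simp [h1]
  obtain ⟨a, ha⟩ : ∃ a, g a ≠ a := by
    by_contra! h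
    exact h1 (Equiv.ext h)
  have h2 := numMoved_eq_unpair_add_two hg ha
  have h3 := ih _ (by omega) (unpair_involutive hg a) rfl
  have h4 : numCycles (f * g) ≤ numCycles (f * unpair g a) + 1 := by
    by_cases hs : (f * unpair g a).SameCycle a (g a)
    · rw [← numCycles_mul_swap_eq_add_one ha.symm hs, mul_unpair_mul_swap]
    · rw [numCycles_eq_mul_swap_add_one hs, mul_unpair_mul_swap]
      omega
  omega

theorem numCycles_mul_unpair {f g : Perm X} {a : X}
    (h : ¬ (f * g).SameCycle a (g a)) :
    numCycles (f * g) = numCycles (f * unpair g a) + 1 := by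
  rw [unpair, ← mul_assoc]
  exact numCycles_eq_mul_swap_add_one h

/-- Each chord of a planar diagram separates two faces: otherwise its removal would create a cycle
while two fewer points are moved, against the genus bound. -/
theorem Planar.not_sameCycle {f g : Perm X} (h : Planar f g) (hg : Function.Involutive g) {a : X}
    (ha : g a ≠ a) : ¬ (f * g).SameCycle a (g a) := by
  intro hs
  have h1 := numCycles_mul_swap_eq_add_one ha.symm hs
  rw [mul_assoc] at h1
  change numCycles (f * unpair g a) = _ at h1
  have h2 := two_mul_numCycles_le f (unpair_involutive hg a)
  have h3 := numMoved_eq_unpair_add_two hg ha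
  unfold Planar at h
  omega

theorem planar_iff_unpair {f g : Perm X} (hg : Function.Involutive g) {a : X}
    (ha : g a ≠ a) (h : ¬ (f * g).SameCycle a (g a)) : Planar f g ↔ Planar f (unpair g a) := by
  have h1 := numCycles_mul_unpair h
  have h3 := numMoved_eq_unpair_add_two hg ha
  unfold Planar
  omega

theorem Planar.unpair {f g : Perm X} (h : Planar f g) (hg : Function.Involutive g) {a : X}
    (ha : g a ≠ a) : Planar f (unpair g a) :=
  (planar_iff_unpair hg ha (h.not_sameCycle hg ha)).1 h

/-- If the pairs of the involution `g` can be glued one after the other, each time to different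
cycles, then every pair diminishes the number of cycles. -/
theorem two_mul_numCycles_add_numMoved {f g : Perm X}
    (h : ∀ g' : Perm X, Function.Involutive g' → (∀ x, g' x = x ∨ g' x = g x) →
      ∀ a, g a ≠ a → g' a = a → ¬ (f * g').SameCycle a (g a)) (hg : Function.Involutive g) :
    2 * numCycles (f * g) + numMoved g = 2 * numCycles f := by
  suffices H : ∀ (n : ℕ) (g' : Perm X), numMoved g' = n → Function.Involutive g' →
      (∀ x, g' x = x ∨ g' x = g x) → 2 * numCycles (f * g') + numMoved g' = 2 * numCycles f from
    H _ g rfl hg fun x => Or.inr rfl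
  intro n
  induction n using Nat.strong_induction_on with | _ n ih
  intro g' hn hg' hsub
  by_cases h1 : g' = 1
  · simp [h1, numMoved]
  obtain ⟨a, ha⟩ : ∃ a, g' a ≠ a := by
    by_contra! h
    exact h1 (Equiv.ext h)
  have hga : g' a = g a := (hsub a).resolve_left ha
  have h2 := numMoved_eq_unpair_add_two hg' ha
  have hsub' : ∀ x, PermCycle.unpair g' a x = x ∨ PermCycle.unpair g' a x = g x := fun x => by
    rcases unpair_eq_or hg' a x with e | e
    · exact Or.inl e
    · rw [e]; exact hsub x
  have h3 := ih _ (by omega) _ rfl (unpair_involutive hg' a) hsub'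
  have h4 := h _ (unpair_involutive hg' a) hsub' a (hga ▸ ha) (unpair_apply_self hg' a)
  rw [← hga] at h4
  have h5 := numCycles_eq_mul_swap_add_one h4
  rw [mul_unpair_mul_swap] at h5
  omega

end Involutions

/-! ### Removal of one point from a permutation. -/

section Skip

variable {X Y : Type*}

/-- `f'` is the permutation induced by `f` when the point `p` is removed; `i` identifies the
remaining points. -/
structure Skips (f : Perm X) (p : X) (i : Y → X) (f' : Perm Y) : Prop where
  inj : Function.Injective i
  ne : ∀ y, i y ≠ p
  surj : ∀ x, x ≠ p → ∃ y, i y = x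
  step : ∀ y, f (i y) = i (f' y) ∨ (f (i y) = p ∧ f p = i (f' y))

variable {f : Perm X} {p : X} {i : Y → X} {f' : Perm Y} [Finite Y]

theorem Skips.sameCycle_map (h : Skips f p i f') {y z : Y} (hyz : f'.SameCycle y z) :
    f.SameCycle (i y) (i z) := by
  refine rel_of_sameCycle (r := fun y z => f.SameCycle (i y) (i z))
    ⟨fun _ => SameCycle.refl _ _, fun h => h.symm, fun h h' => h.trans h'⟩ (fun y => ?_) hyz
  rcases h.step y with e | ⟨e, e'⟩
  · exact ⟨1, by simpa using e⟩
  · exact ⟨2, by rw [show (2 : ℤ) = 1 + 1 from rfl, zpow_add]; simp [e, e']⟩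

variable [Finite X]

theorem Skips.sameCycle_iff (h : Skips f p i f') {y z : Y} :
    f.SameCycle (i y) (i z) ↔ f'.SameCycle y z := by
  refine ⟨fun hyz => ?_, h.sameCycle_map⟩
  -- The `f`-orbit may pass through `p`, so the invariant set contains `p` whenever its successor is
  -- good.
  have key : i z ∈ {x | (∃ w, i w = x ∧ f'.SameCycle y w) ∨
      (x = p ∧ ∃ w, f p = i w ∧ f'.SameCycle y w)} := by
    refine mem_of_sameCycle ?_ hyz (Or.inl ⟨y, rfl, SameCycle.refl _ _⟩)
    rintro x (⟨w, rfl, hw⟩ | ⟨rfl, w, hw, hw'⟩)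
    · rcases h.step w with e | ⟨e, e'⟩
      · exact Or.inl ⟨_, e.symm, sameCycle_apply_right.2 hw⟩
      · exact Or.inr ⟨e, _, e', sameCycle_apply_right.2 hw⟩
    · exact Or.inl ⟨w, hw.symm, hw'⟩
  rcases key with ⟨w, hw, hw'⟩ | ⟨e, _⟩
  · exact h.inj hw ▸ hw'
  · exact absurd e (h.ne z)

theorem Skips.cycleSize_eq (h : Skips f p i f') {y : Y} (hy : ¬ f.SameCycle (i y) p) :
    cycleSize f (i y) = cycleSize f' y := by
  symm
  refine Nat.card_eq_of_bijective (fun z : {z // f'.SameCycle y z} =>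
    (⟨i z, h.sameCycle_iff.2 z.2⟩ : {x // f.SameCycle (i y) x})) ⟨?_, ?_⟩
  · rintro ⟨z, hz⟩ ⟨w, hw⟩ e
    exact Subtype.ext (h.inj (congrArg Subtype.val e))
  · rintro ⟨x, hx⟩
    obtain ⟨z, rfl⟩ := h.surj x fun e => hy (e ▸ hx)
    exact ⟨⟨z, h.sameCycle_iff.1 hx⟩, rfl⟩

theorem Skips.cycleSize_eq_add_one (h : Skips f p i f') {y : Y} (hy : f.SameCycle (i y) p) :
    cycleSize f (i y) = cycleSize f' y + 1 := by
  have h1 : cycleSize f (i y) = {x | f.SameCycle (i y) x}.ncard := rfl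
  have h2 : cycleSize f' y = {z | f'.SameCycle y z}.ncard := rfl
  have h3 : {x | f.SameCycle (i y) x} = insert p (i '' {z | f'.SameCycle y z}) := by
    ext x
    simp only [Set.mem_ofPred_eq, Set.mem_insert_iff, Set.mem_image]
    constructor
    · intro hx
      by_cases e : x = p
      · exact Or.inl e
      · obtain ⟨z, rfl⟩ := h.surj x e
        exact Or.inr ⟨z, h.sameCycle_iff.1 hx, rfl⟩
    · rintro (rfl | ⟨z, hz, rfl⟩)
      · exact hy
      · exact h.sameCycle_iff.2 hz
  rw [h1, h2, h3, Set.ncard_insert_of_notMem, Set.ncard_image_of_injective _ h.inj]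
  rintro ⟨z, _, e⟩
  exact h.ne z e

theorem Skips.numCycles_eq (h : Skips f p i f') (hp : f p ≠ p) :
    numCycles f = numCycles f' := by
  symm
  refine Nat.card_eq_of_bijective (Quotient.map' (s₁ := SameCycle.setoid f')
    (s₂ := SameCycle.setoid f) i fun _ _ hyz => h.sameCycle_map hyz) ⟨?_, ?_⟩
  · intro q q' e
    induction q using Quotient.inductionOn with | _ y
    induction q' using Quotient.inductionOn with | _ z
    exact Quotient.sound (h.sameCycle_iff.1 (Quotient.exact e))
  · intro q
    induction q using Quotient.inductionOn with | _ x
    by_cases hx : x = p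
    · obtain ⟨y, hy⟩ := h.surj _ hp
      refine ⟨Quotient.mk _ y, Quotient.sound (?_ : f.SameCycle (i y) x)⟩
      rw [hy, hx]
      exact sameCycle_apply_left.2 (SameCycle.refl _ _)
    · obtain ⟨y, rfl⟩ := h.surj x hx
      exact ⟨Quotient.mk _ y, rfl⟩

end Skip

section Periods

variable {X : Type*} [Finite X]

theorem cycleSize_eq_minimalPeriod (f : Perm X) (x : X) :
    cycleSize f x = Function.minimalPeriod f x := by
  have := Fintype.ofFinite (MulAction.orbit (Subgroup.zpowers f) x)
  have h := MulAction.minimalPeriod_eq_card (a := f) (b := x)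
  rw [← Nat.card_eq_fintype_card] at h
  rw [cycleSize, show Function.minimalPeriod f x = Function.minimalPeriod (f • ·) x from rfl, h]
  refine Nat.card_congr (Equiv.subtypeEquivRight fun y => ?_)
  constructor
  · rintro ⟨n, hn⟩
    exact ⟨⟨f ^ n, n, rfl⟩, hn⟩
  · rintro ⟨⟨_, n, rfl⟩, hn⟩
    exact ⟨n, hn⟩

theorem pow_cycleSize (f : Perm X) (x : X) : (f ^ cycleSize f x) x = x := by
  rw [cycleSize_eq_minimalPeriod, ← iterate_eq_pow]
  exact Function.isPeriodicPt_minimalPeriod f x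

theorem cycleSize_le_of_pow {f : Perm X} {x : X} {k : ℕ} (hk : 0 < k) (h : (f ^ k) x = x) :
    cycleSize f x ≤ k := by
  rw [cycleSize_eq_minimalPeriod]
  rw [← iterate_eq_pow] at h
  exact Function.IsPeriodicPt.minimalPeriod_le hk h

theorem pow_injOn_cycleSize {f : Perm X} {x : X} {k l : ℕ} (hkl : k < l) (hl : l < k + cycleSize f x) :
    (f ^ k) x ≠ (f ^ l) x := by
  intro h
  have h1 : (f ^ (l - k)) x = x := by
    apply (f ^ k).injective
    rw [← Perm.mul_apply, ← pow_add, Nat.add_sub_cancel' hkl.le, h]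
  have := cycleSize_le_of_pow (by omega) h1
  omega

end Periods

section CycleSizes

variable {X : Type*} [Finite X] [DecidableEq X] {f : Perm X} {a b : X}

theorem cycleSize_mul_swap (h : ¬ f.SameCycle a b) :
    cycleSize (f * swap a b) a = cycleSize f a + cycleSize f b := by
  have h1 : cycleSize (f * swap a b) a = ({x | f.SameCycle a x} ∪ {x | f.SameCycle b x}).ncard := by
    refine congrArg Set.ncard (Set.ext fun x => ?_)
    change (f * swap a b).SameCycle a x ↔ f.SameCycle a x ∨ f.SameCycle b x
    rw [sameCycle_mul_swap_iff h]
    simp only [SameCycle.refl, true_or, true_and, or_iff_right_iff_imp]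
    exact Or.inl
  rw [h1, Set.ncard_union_eq]
  · rfl
  · exact Set.disjoint_left.2 fun x hx hx' => h (SameCycle.trans hx (SameCycle.symm hx'))

theorem cycleSize_mul_swap_of_not {x : X} (h : ¬ f.SameCycle a b) (ha : ¬ f.SameCycle a x)
    (hb : ¬ f.SameCycle b x) : cycleSize (f * swap a b) x = cycleSize f x := by
  refine Nat.card_congr (Equiv.subtypeEquivRight fun y => ?_)
  rw [sameCycle_mul_swap_iff h]
  simp [ha, hb]

end CycleSizes

end PermCycle

namespace PermCycle

/-! ### Insertion of a fixed point on the circle. -/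

section Insertion

variable {n : ℕ}

/-- Inserts a fixed point at `p`. -/
def insertFixed (p : Fin (n + 1)) (g : Perm (Fin n)) : Perm (Fin (n + 1)) :=
  (finSuccEquiv' p).symm.permCongr (optionCongr g)

@[simp] theorem insertFixed_self (p : Fin (n + 1)) (g : Perm (Fin n)) : insertFixed p g p = p := by
  simp [insertFixed, permCongr_apply]

@[simp] theorem insertFixed_succAbove (p : Fin (n + 1)) (g : Perm (Fin n)) (y : Fin n) :
    insertFixed p g (p.succAbove y) = p.succAbove (g y) := by
  simp [insertFixed, permCongr_apply]

@[simp] theorem insertFixed_zero_succ (g : Perm (Fin n)) (y : Fin n) :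
    insertFixed 0 g y.succ = (g y).succ := by
  simpa using insertFixed_succAbove 0 g y

theorem insertFixed_injective (p : Fin (n + 1)) : Function.Injective (insertFixed p) := by
  intro g h e
  ext y : 1
  apply Fin.succAbove_right_injective (p := p)
  rw [← insertFixed_succAbove, ← insertFixed_succAbove, e]

theorem exists_insertFixed {p : Fin (n + 1)} {g : Perm (Fin (n + 1))} (h : g p = p) :
    ∃ g', insertFixed p g' = g := by
  refine ⟨removeNone ((finSuccEquiv' p).permCongr g), Equiv.ext fun x => ?_⟩
  rcases Fin.eq_self_or_eq_succAbove p x with rfl | ⟨y, rfl⟩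
  · rw [insertFixed_self, h]
  · obtain ⟨z, hz⟩ := Fin.exists_succAbove_eq (x := g (p.succAbove y)) (y := p)
      fun e => Fin.succAbove_ne p y (g.injective (e.trans h.symm))
    have h1 : (finSuccEquiv' p).permCongr g (some y) = some z := by
      simp [permCongr_apply, ← hz]
    have h2 := removeNone_some ((finSuccEquiv' p).permCongr g) ⟨z, h1⟩
    rw [h1] at h2
    rw [insertFixed_succAbove, Option.some.inj h2, hz]

theorem insertFixed_involutive_iff {p : Fin (n + 1)} {g : Perm (Fin n)} :
    Function.Involutive (insertFixed p g) ↔ Function.Involutive g := by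
  constructor
  · intro h y
    apply Fin.succAbove_right_injective (p := p)
    rw [← insertFixed_succAbove, ← insertFixed_succAbove, h]
  · intro h x
    rcases Fin.eq_self_or_eq_succAbove p x with rfl | ⟨y, rfl⟩
    · simp
    · rw [insertFixed_succAbove, insertFixed_succAbove, h]

theorem numMoved_insertFixed (p : Fin (n + 1)) (g : Perm (Fin n)) :
    numMoved (insertFixed p g) = numMoved g := by
  symm
  refine Nat.card_eq_of_bijective (fun y : {y // g y ≠ y} =>
    (⟨p.succAbove y, by simpa using y.2⟩ : {x // insertFixed p g x ≠ x})) ⟨?_, ?_⟩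
  · rintro ⟨y, hy⟩ ⟨z, hz⟩ e
    exact Subtype.ext (Fin.succAbove_right_injective (congrArg Subtype.val e))
  · rintro ⟨x, hx⟩
    rcases Fin.eq_self_or_eq_succAbove p x with rfl | ⟨y, rfl⟩
    · exact absurd (insertFixed_self _ g) hx
    · exact ⟨⟨y, by simpa using hx⟩, rfl⟩

theorem val_finRotate (x : Fin (n + 1)) :
    (finRotate (n + 1) x : ℕ) = if (x : ℕ) = n then 0 else (x : ℕ) + 1 := by
  rw [coe_finRotate]
  simp [Fin.ext_iff]

theorem val_succAbove (p : Fin (n + 1)) (y : Fin n) :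
    (p.succAbove y : ℕ) = if (y : ℕ) < p then (y : ℕ) else (y : ℕ) + 1 := by
  rw [Fin.succAbove]
  split_ifs <;> simp_all [Fin.lt_def]

/-- An unmatched point merely lengthens by one the face cycle in which it lies. All later deletions
of points rest on this. -/
theorem skips_finRotate_mul (p : Fin (n + 2)) (g : Perm (Fin (n + 1))) :
    Skips (finRotate (n + 2) * insertFixed p g) p p.succAbove (finRotate (n + 1) * g) where
  inj := Fin.succAbove_right_injective
  ne := Fin.succAbove_ne p
  surj x hx := Fin.exists_succAbove_eq hx
  step y := by
    simp only [Perm.mul_apply, insertFixed_succAbove, insertFixed_self]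
    generalize g y = w
    have hw := w.2
    have hp := p.2
    simp only [Fin.ext_iff, val_finRotate, val_succAbove]
    split_ifs <;> omega

theorem sameCycle_finRotate (x y : Fin (n + 1)) : (finRotate (n + 1)).SameCycle x y := by
  suffices h : ∀ x, (finRotate (n + 1)).SameCycle 0 x from (h x).symm.trans (h y)
  intro x
  induction x using Fin.induction with
  | zero => exact SameCycle.refl _ _
  | succ x ih =>
    have : x.succ = finRotate (n + 1) x.castSucc := by
      ext
      have := x.2
      rw [val_finRotate, if_neg (by simp; omega)]
      simp
    rw [this]
    exact sameCycle_apply_right.2 ih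

theorem numCycles_eq_one {X : Type*} [Finite X] [Nonempty X] {f : Perm X}
    (h : ∀ x y, f.SameCycle x y) : numCycles f = 1 := by
  rw [numCycles, Nat.card_eq_one_iff_unique]
  refine ⟨⟨fun q q' => ?_⟩, Nonempty.map (Quotient.mk _) inferInstance⟩
  induction q using Quotient.inductionOn with | _ y
  induction q' using Quotient.inductionOn with | _ z
  exact Quotient.sound (h y z)

theorem numCycles_finRotate (n : ℕ) : numCycles (finRotate (n + 1)) = 1 :=
  numCycles_eq_one sameCycle_finRotate

end Insertion

/-! ### Insertion of a chord at the point `0`. -/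

section Chord

variable {n : ℕ}

/-- Inserts a pair `{0, b + 1}`. -/
def insertPair (b : Fin (n + 2)) (g : Perm (Fin (n + 1))) : Perm (Fin (n + 3)) :=
  insertFixed 0 (insertFixed b g) * swap 0 b.succ

variable {b : Fin (n + 2)} {g : Perm (Fin (n + 1))}

@[simp] theorem insertPair_zero : insertPair b g 0 = b.succ := by
  simp [insertPair]

@[simp] theorem insertPair_succ : insertPair b g b.succ = 0 := by
  simp [insertPair]

@[simp] theorem insertPair_succ_succAbove (y : Fin (n + 1)) :
    insertPair b g (b.succAbove y).succ = (b.succAbove (g y)).succ := by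
  rw [insertPair, Perm.mul_apply, swap_apply_of_ne_of_ne (Fin.succ_ne_zero _), insertFixed_zero_succ,
    insertFixed_succAbove]
  simp [Fin.succ_inj, Fin.succAbove_ne]

theorem insertPair_cases (b : Fin (n + 2)) (x : Fin (n + 3)) :
    x = 0 ∨ x = b.succ ∨ ∃ y, x = (b.succAbove y).succ := by
  rcases Fin.eq_self_or_eq_succAbove 0 x with rfl | ⟨z, rfl⟩
  · exact Or.inl rfl
  · rcases Fin.eq_self_or_eq_succAbove b z with rfl | ⟨y, rfl⟩ <;> simp

theorem insertPair_involutive (hg : Function.Involutive g) :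
    Function.Involutive (insertPair b g) := by
  intro x
  rcases insertPair_cases b x with rfl | rfl | ⟨y, rfl⟩ <;> simp [hg _]

theorem unpair_insertPair : unpair (insertPair b g) 0 = insertFixed 0 (insertFixed b g) := by
  rw [unpair, insertPair_zero, insertPair, mul_assoc, swap_mul_self, mul_one]

theorem numMoved_insertPair (hg : Function.Involutive g) :
    numMoved (insertPair b g) = numMoved g + 2 := by
  rw [numMoved_eq_unpair_add_two (insertPair_involutive hg) (a := 0) (by simp),
    unpair_insertPair, numMoved_insertFixed, numMoved_insertFixed]

theorem exists_insertPair {h : Perm (Fin (n + 3))} (hh : Function.Involutive h) (h0 : h 0 ≠ 0) :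
    ∃ (b : Fin (n + 2)) (g : Perm (Fin (n + 1))), Function.Involutive g ∧ insertPair b g = h := by
  obtain ⟨b, hb⟩ := Fin.exists_succ_eq.2 h0
  obtain ⟨h', hh'⟩ := exists_insertFixed (unpair_apply_self hh 0)
  have h1 : h' b = b := by
    apply Fin.succ_injective
    rw [← insertFixed_zero_succ, hh', hb, unpair_apply_image]
  obtain ⟨g, rfl⟩ := exists_insertFixed h1
  refine ⟨b, g, ?_, ?_⟩
  · rw [← insertFixed_involutive_iff (p := b), ← insertFixed_involutive_iff (p := 0), hh']
    exact unpair_involutive hh 0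
  · rw [insertPair, hh', hb, unpair_mul_swap]

theorem insertPair_injective {b' : Fin (n + 2)} {g' : Perm (Fin (n + 1))}
    (h : insertPair b g = insertPair b' g') : b = b' ∧ g = g' := by
  have hb : b = b' := by
    apply Fin.succ_injective
    rw [← insertPair_zero (g := g), h, insertPair_zero]
  subst hb
  exact ⟨rfl, insertFixed_injective _ (insertFixed_injective _ (mul_right_cancel h))⟩

/-- The face permutation after insertion of a pair, and before it. -/
local notation "Φ" => finRotate (n + 3) * insertPair b g
local notation "Φ₀" => finRotate (n + 1) * g
local notation "Ψ" => finRotate (n + 3) * insertFixed 0 (insertFixed b g)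
local notation "Ψ₁" => finRotate (n + 2) * insertFixed b g

theorem insertFixed_mul_swap : Ψ * swap 0 b.succ = Φ := by
  rw [mul_assoc, insertPair]

theorem insertPair_mul_swap : Φ * swap 0 b.succ = Ψ := by
  rw [← insertFixed_mul_swap, mul_assoc, swap_mul_self, mul_one]

theorem skips_zero : Skips Ψ 0 Fin.succ Ψ₁ := by
  have := skips_finRotate_mul 0 (insertFixed b g)
  rwa [Fin.succAbove_zero] at this

theorem sameCycle_insertFixed_iff : (Ψ).SameCycle 0 b.succ ↔ ¬ (Φ).SameCycle 0 b.succ := by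
  constructor
  · intro h
    rw [← insertFixed_mul_swap]
    exact not_sameCycle_mul_swap (Fin.succ_ne_zero b).symm h
  · intro h
    rw [← insertPair_mul_swap]
    exact sameCycle_mul_swap h

theorem sameCycle_zero_succAbove : (Ψ₁).SameCycle 0 (b.succAbove 0) := by
  by_cases hb : b = 0
  · subst hb
    refine ⟨1, ?_⟩
    simp
  · rw [Fin.succAbove_ne_zero_zero hb]

theorem sameCycle_zero_succ : (Ψ).SameCycle 0 (Fin.succ 0) := ⟨1, by simp⟩

theorem numCycles_insertPair (h : ¬ (Φ).SameCycle 0 b.succ) : numCycles Φ = numCycles Φ₀ + 1 := by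
  rw [numCycles_eq_mul_swap_add_one h, insertPair_mul_swap, skips_zero.numCycles_eq,
    (skips_finRotate_mul b g).numCycles_eq]
  · simp
  · simp

theorem sameCycle_succ_of_not (h : ¬ (Φ).SameCycle 0 b.succ) : (Ψ₁).SameCycle 0 b := by
  rw [← skips_zero.sameCycle_iff]
  exact sameCycle_zero_succ.symm.trans (sameCycle_insertFixed_iff.2 h)

/-- Undoing the transposition merges the two faces on either side of the chord; both ends then lie
as unmatched points in the merged face, and deleting each costs one. -/
theorem cycleSize_insertPair_zero (h : ¬ (Φ).SameCycle 0 b.succ) :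
    cycleSize Φ 0 + cycleSize Φ b.succ = cycleSize Φ₀ 0 + 2 := by
  rw [← cycleSize_mul_swap h, insertPair_mul_swap, cycleSize_congr sameCycle_zero_succ,
    skips_zero.cycleSize_eq_add_one sameCycle_zero_succ.symm,
    cycleSize_congr sameCycle_zero_succAbove,
    (skips_finRotate_mul b g).cycleSize_eq_add_one]
  exact sameCycle_zero_succAbove.symm.trans (sameCycle_succ_of_not h)

/-- The two faces along the chord are together the old root face, apart from the ends of the chord.
-/
theorem sameCycle_insertPair_iff (h : ¬ (Φ).SameCycle 0 b.succ) (y : Fin (n + 1)) :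
    ((Φ).SameCycle 0 (b.succAbove y).succ ∨ (Φ).SameCycle b.succ (b.succAbove y).succ) ↔
      (Φ₀).SameCycle 0 y := by
  rw [← (skips_finRotate_mul b g).sameCycle_iff, ← skips_zero.sameCycle_iff]
  have h1 := sameCycle_mul_swap_iff h (x := 0) (y := (b.succAbove y).succ)
  rw [insertPair_mul_swap] at h1
  have h2 : (Ψ).SameCycle 0 (b.succAbove 0).succ :=
    sameCycle_zero_succ.trans (skips_zero.sameCycle_iff.2 sameCycle_zero_succAbove)
  have h3 : (Ψ).SameCycle (b.succAbove 0).succ (b.succAbove y).succ ↔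
      (Ψ).SameCycle 0 (b.succAbove y).succ := ⟨h2.trans, h2.symm.trans⟩
  rw [h3, h1]
  constructor
  · exact fun e => Or.inr ⟨Or.inl (SameCycle.refl _ _), e⟩
  · rintro (e | ⟨_, e⟩)
    · exact Or.inl e
    · exact e

theorem cycleSize_insertPair_of_not (h : ¬ (Φ).SameCycle 0 b.succ) {y : Fin (n + 1)}
    (hy : ¬ (Φ₀).SameCycle 0 y) :
    cycleSize Φ (b.succAbove y).succ = cycleSize Φ₀ y := by
  have h0 := (not_congr (sameCycle_insertPair_iff h y)).2 hy
  rw [not_or] at h0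
  rw [← cycleSize_mul_swap_of_not h h0.1 h0.2, insertPair_mul_swap, skips_zero.cycleSize_eq,
    (skips_finRotate_mul b g).cycleSize_eq]
  · intro e
    refine hy ((skips_finRotate_mul b g).sameCycle_iff.1 ?_)
    exact sameCycle_zero_succAbove.symm.trans ((sameCycle_succ_of_not h).trans e.symm)
  · intro e
    refine hy ((skips_finRotate_mul b g).sameCycle_iff.1 ?_)
    refine sameCycle_zero_succAbove.symm.trans (skips_zero.sameCycle_iff.1 ?_)
    exact sameCycle_zero_succ.symm.trans e.symm

end Chord

end PermCycle

namespace PermCycle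

theorem pow_succ_apply {X : Type*} (f : Perm X) (k : ℕ) (x : X) :
    (f ^ (k + 1)) x = f ((f ^ k) x) := by
  rw [pow_succ', Perm.mul_apply]

/-! ### The position of the chord determined by the size of the face that it cuts off. -/

section Position

variable {n : ℕ}

/-- The place before `z` in the linear order, which is the end for `z = 0`. -/
def placeBefore (z : Fin (n + 1)) : Fin (n + 2) :=
  if z = 0 then Fin.last (n + 1) else z.castSucc

theorem val_placeBefore (z : Fin (n + 1)) :
    (placeBefore z : ℕ) = if (z : ℕ) = 0 then n + 1 else (z : ℕ) := by
  simp only [placeBefore, Fin.ext_iff, Fin.val_zero]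
  split_ifs <;> rfl

theorem placeBefore_ne_zero (z : Fin (n + 1)) : placeBefore z ≠ 0 := by
  intro h
  have h := congrArg Fin.val h
  rw [val_placeBefore, Fin.val_zero] at h
  split_ifs at h
  contradiction

theorem placeBefore_injective : Function.Injective (placeBefore (n := n)) := by
  intro y z h
  have hy := y.2
  have hz := z.2
  rw [Fin.ext_iff, val_placeBefore, val_placeBefore] at h
  ext
  split_ifs at h <;> omega

theorem finRotate_succ_succAbove (b : Fin (n + 2)) (w : Fin (n + 1)) :
    (finRotate (n + 3) (b.succAbove w).succ = b.succ ↔ b = placeBefore (finRotate (n + 1) w)) ∧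
    (finRotate (n + 3) (b.succAbove w).succ ≠ b.succ →
      finRotate (n + 3) (b.succAbove w).succ ≠ 0 →
      finRotate (n + 3) (b.succAbove w).succ = (b.succAbove (finRotate (n + 1) w)).succ) ∧
    (finRotate (n + 3) (b.succAbove w).succ = 0 → finRotate (n + 1) w = 0) := by
  have hw := w.2
  have hb := b.2
  have h1 := val_finRotate w
  have h2 : (finRotate (n + 3) (b.succAbove w).succ : ℕ) = _ := val_finRotate _
  rw [Fin.val_succ, val_succAbove] at h2
  simp only [ne_eq, Fin.ext_iff, val_placeBefore, Fin.val_succ, Fin.val_zero, val_succAbove]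
  refine ⟨?_, ?_, ?_⟩ <;> split_ifs at * <;> omega

variable {b : Fin (n + 2)} {g : Perm (Fin (n + 1))}

local notation "Φ" => finRotate (n + 3) * insertPair b g
local notation "Φ₀" => finRotate (n + 1) * g

theorem insertPair_apply_eq_iff (y : Fin (n + 1)) :
    (Φ) (b.succAbove y).succ = b.succ ↔ b = placeBefore ((Φ₀) y) := by
  rw [Perm.mul_apply, insertPair_succ_succAbove]
  exact (finRotate_succ_succAbove b (g y)).1

theorem insertPair_apply_of_ne {y : Fin (n + 1)} (h : (Φ) (b.succAbove y).succ ≠ b.succ)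
    (h' : (Φ) (b.succAbove y).succ ≠ 0) :
    (Φ) (b.succAbove y).succ = (b.succAbove ((Φ₀) y)).succ := by
  rw [Perm.mul_apply, insertPair_succ_succAbove] at *
  exact (finRotate_succ_succAbove b (g y)).2.1 h h'

theorem insertPair_apply_eq_zero {y : Fin (n + 1)} (h : (Φ) (b.succAbove y).succ = 0) :
    (Φ₀) y = 0 := by
  rw [Perm.mul_apply, insertPair_succ_succAbove] at h
  exact (finRotate_succ_succAbove b (g y)).2.2 h

theorem insertPair_apply_image : (Φ) b.succ = Fin.succ 0 := by
  simp

theorem insertPair_apply_image_of_ne (hb : b ≠ 0) : (Φ) b.succ = (b.succAbove 0).succ := by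
  rw [insertPair_apply_image, Fin.succAbove_ne_zero_zero hb]

/-- The place of `b` for which the cycle of `b + 1` has size `j + 1`. -/
def pairPlace (g : Perm (Fin (n + 1))) (j : ℕ) : Fin (n + 2) :=
  if j = 0 then 0 else placeBefore (((finRotate (n + 1) * g) ^ j) 0)

/-- From `b + 1` the new face steps to the old `0` and runs along the old root cycle. It closes up
just when the next old point is the one before which `b` stands, which happens after `j` old points.
-/
theorem eq_pairPlace (h : ¬ (Φ).SameCycle 0 b.succ) {j : ℕ}
    (hj : cycleSize Φ b.succ = j + 1) : b = pairPlace g j := by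
  rw [pairPlace]
  split_ifs with h0
  · subst h0
    have h1 := pow_cycleSize Φ b.succ
    rw [hj, pow_one, insertPair_apply_image] at h1
    exact (Fin.succ_injective _ h1).symm
  · have hb : b ≠ 0 := by
      rintro rfl
      have := cycleSize_le_of_pow one_pos (f := finRotate (n + 3) * insertPair 0 g)
        (x := Fin.succ 0) (by rw [pow_one, insertPair_apply_image])
      omega
    have key : ∀ k < j, ((Φ) ^ (k + 1)) b.succ = (b.succAbove (((Φ₀) ^ k) 0)).succ := by
      intro k
      induction k with
      | zero => intro _; simpa using insertPair_apply_image_of_ne (g := g) hb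
      | succ k ih =>
        intro hk
        have h1 := ih (by omega)
        rw [pow_succ_apply, h1, insertPair_apply_of_ne, ← pow_succ_apply]
        · rw [← h1, ← pow_succ_apply]
          intro e
          have := cycleSize_le_of_pow (by omega) e
          omega
        · rw [← h1, ← pow_succ_apply]
          intro e
          exact h (SameCycle.symm ⟨(k + 1 + 1 : ℕ), e⟩)
    obtain ⟨k, rfl⟩ := Nat.exists_eq_succ_of_ne_zero h0
    have h1 := pow_cycleSize Φ b.succ
    rw [hj, pow_succ_apply, key k (by omega), insertPair_apply_eq_iff, ← pow_succ_apply] at h1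
    exact h1

/-- The bound on `j` ensures that the run along the old root cycle neither meets the place of `b`
too early nor wraps through the new `0`. At equality the whole root cycle is cut off and the chord
ends at the last place. -/
theorem pairPlace_spec {j : ℕ} (hj : j ≤ cycleSize Φ₀ 0) (hb : b = pairPlace g j) :
    ¬ (Φ).SameCycle 0 b.succ ∧ cycleSize Φ b.succ = j + 1 := by
  have key : ∀ k < j, ((Φ) ^ (k + 1)) b.succ = (b.succAbove (((Φ₀) ^ k) 0)).succ := by
    intro k hk
    rw [pairPlace, if_neg (by omega)] at hb
    induction k with
    | zero => simpa using insertPair_apply_image_of_ne (g := g) (hb ▸ placeBefore_ne_zero _)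
    | succ k ih =>
      rw [pow_succ_apply, ih (by omega), insertPair_apply_of_ne, ← pow_succ_apply]
      · rw [ne_eq, insertPair_apply_eq_iff, ← pow_succ_apply]
        intro e
        exact pow_injOn_cycleSize hk (by omega) (placeBefore_injective (e.symm.trans hb))
      · intro e
        have e := insertPair_apply_eq_zero e
        rw [← pow_succ_apply] at e
        have := cycleSize_le_of_pow (by omega) e
        omega
  have hlast : ((Φ) ^ (j + 1)) b.succ = b.succ := by
    rw [pow_succ_apply]
    rcases j with _ | j
    · have : b = 0 := by simpa [pairPlace] using hb
      subst this
      exact insertPair_apply_image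
    · rw [key j (by omega), insertPair_apply_eq_iff, ← pow_succ_apply, hb, pairPlace,
        if_neg (by omega)]
  constructor
  · intro e
    have : (0 : Fin (n + 3)) ∈
        {x | x = b.succ ∨ ∃ k < j, x = (b.succAbove (((Φ₀) ^ k) 0)).succ} := by
      refine mem_of_sameCycle ?_ e.symm (Or.inl rfl)
      have hstep : ∀ k ≤ j, ((Φ) ^ (k + 1)) b.succ = b.succ ∨
          ∃ l < j, ((Φ) ^ (k + 1)) b.succ = (b.succAbove (((Φ₀) ^ l) 0)).succ := by
        intro k hk
        rcases hk.lt_or_eq with hk | rfl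
        · exact Or.inr ⟨k, hk, key k hk⟩
        · exact Or.inl hlast
      rintro x (rfl | ⟨k, hk, rfl⟩)
      · simpa using hstep 0 (Nat.zero_le _)
      · rw [← key k hk, ← pow_succ_apply]
        exact hstep (k + 1) hk
    rcases this with e | ⟨k, _, e⟩
    · exact Fin.succ_ne_zero _ e.symm
    · exact Fin.succ_ne_zero _ e.symm
  · refine le_antisymm (cycleSize_le_of_pow (by omega) hlast) ?_
    by_contra hlt
    have h1 := pow_cycleSize Φ b.succ
    have h2 := cycleSize_pos Φ b.succ
    obtain ⟨k, hk⟩ := Nat.exists_eq_succ_of_ne_zero h2.ne'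
    rw [hk, Nat.succ_eq_add_one, key k (by omega)] at h1
    exact Fin.succAbove_ne _ _ (Fin.succ_injective _ h1)

end Position

/-! ### Recurrences obtained by deleting the point `0`. -/

section Counting

/-- Planar involutions with `m` pairs for which the cycle of `0` of the face permutation has size
`d` and the sizes of the other cycles satisfy `P`. -/
structure Admissible (P : ℕ → Prop) (n m d : ℕ) (g : Perm (Fin (n + 1))) : Prop where
  involutive : Function.Involutive g
  numMoved_eq : numMoved g = 2 * m
  numCycles_eq : numCycles (finRotate (n + 1) * g) = m + 1
  root : cycleSize (finRotate (n + 1) * g) 0 = d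
  other : ∀ x, ¬ (finRotate (n + 1) * g).SameCycle 0 x → P (cycleSize (finRotate (n + 1) * g) x)

noncomputable def countAdmissible (P : ℕ → Prop) (n m d : ℕ) : ℕ :=
  Nat.card {g : Perm (Fin (n + 1)) // Admissible P n m d g}

variable {P : ℕ → Prop} {n m d e : ℕ}

theorem planar_finRotate_iff {g : Perm (Fin (n + 1))} (h : numMoved g = 2 * m) :
    Planar (finRotate (n + 1)) g ↔ numCycles (finRotate (n + 1) * g) = m + 1 := by
  rw [Planar, h, numCycles_finRotate]
  omega

theorem Admissible.planar {g : Perm (Fin (n + 1))} (h : Admissible P n m d g) :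
    Planar (finRotate (n + 1)) g :=
  (planar_finRotate_iff h.numMoved_eq).2 h.numCycles_eq

theorem admissible_insertFixed_iff {g : Perm (Fin (n + 1))} :
    Admissible P (n + 1) m (d + 1) (insertFixed 0 g) ↔ Admissible P n m d g := by
  have hs := skips_finRotate_mul 0 g
  rw [Fin.succAbove_zero] at hs
  have h0 : (finRotate (n + 1 + 1) * insertFixed 0 g).SameCycle 0 (Fin.succ 0) := ⟨1, by simp⟩
  have h1 := hs.numCycles_eq (by simp)
  have h2 : cycleSize (finRotate (n + 1 + 1) * insertFixed 0 g) 0 =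
      cycleSize (finRotate (n + 1) * g) 0 + 1 := by
    rw [cycleSize_congr h0, hs.cycleSize_eq_add_one h0.symm]
  have h3 : ∀ y, (finRotate (n + 1 + 1) * insertFixed 0 g).SameCycle 0 y.succ ↔
      (finRotate (n + 1) * g).SameCycle 0 y := fun y => by
    rw [← hs.sameCycle_iff]
    exact ⟨h0.symm.trans, h0.trans⟩
  have h4 : ∀ y, ¬ (finRotate (n + 1) * g).SameCycle 0 y →
      cycleSize (finRotate (n + 1 + 1) * insertFixed 0 g) y.succ =
        cycleSize (finRotate (n + 1) * g) y := fun y hy =>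
    hs.cycleSize_eq fun e => hy ((h3 y).1 e.symm)
  constructor
  · rintro ⟨a1, a2, a3, a4, a5⟩
    refine ⟨insertFixed_involutive_iff.1 a1, by rw [← a2, numMoved_insertFixed],
      by rw [← h1, a3], by omega, fun y hy => ?_⟩
    rw [← h4 y hy]
    exact a5 _ fun e => hy ((h3 y).1 e)
  · rintro ⟨a1, a2, a3, a4, a5⟩
    refine ⟨insertFixed_involutive_iff.2 a1, by rw [← a2, numMoved_insertFixed],
      by rw [h1, a3], by omega, fun x hx => ?_⟩
    rcases Fin.eq_self_or_eq_succAbove 0 x with rfl | ⟨y, rfl⟩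
    · exact absurd (SameCycle.refl _ _) hx
    · rw [Fin.succAbove_zero] at hx ⊢
      rw [h3] at hx
      rw [h4 y hx]
      exact a5 y hx

theorem card_admissible_zero_fixed :
    Nat.card {g // Admissible P (n + 1) m (d + 1) g ∧ g 0 = 0} = countAdmissible P n m d := by
  symm
  refine Nat.card_eq_of_bijective (fun g : {g // Admissible P n m d g} =>
    ⟨insertFixed 0 g.1, admissible_insertFixed_iff.2 g.2, insertFixed_self 0 g.1⟩) ⟨?_, ?_⟩
  · rintro ⟨g, hg⟩ ⟨g', hg'⟩ e
    exact Subtype.ext (insertFixed_injective 0 (congrArg Subtype.val e))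
  · rintro ⟨g, hg, h0⟩
    obtain ⟨g', rfl⟩ := exists_insertFixed h0
    exact ⟨⟨g', admissible_insertFixed_iff.1 hg⟩, rfl⟩

theorem admissible_insertPair {g : Perm (Fin (n + 1))} (hg : Admissible P n m (d + e) g)
    (he : P (e + 1)) :
    Admissible P (n + 2) (m + 1) (d + 1) (insertPair (pairPlace g e) g) ∧
      cycleSize (finRotate (n + 3) * insertPair (pairPlace g e) g)
        (insertPair (pairPlace g e) g 0) = e + 1 := by
  obtain ⟨h1, h2⟩ := pairPlace_spec (by rw [hg.root]; omega) (rfl : pairPlace g e = _)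
  generalize pairPlace g e = b at *
  have h3 := cycleSize_insertPair_zero h1
  rw [h2, hg.root] at h3
  have h4 : cycleSize (finRotate (n + 2 + 1) * insertPair b g) 0 = d + 1 := by
    change cycleSize (finRotate (n + 3) * insertPair b g) 0 = d + 1
    omega
  refine ⟨⟨insertPair_involutive hg.involutive, ?_, ?_, h4, fun x hx => ?_⟩, ?_⟩
  · rw [numMoved_insertPair hg.involutive, hg.numMoved_eq]
    ring
  · rw [numCycles_insertPair h1, hg.numCycles_eq]
  · by_cases hb : (finRotate (n + 3) * insertPair b g).SameCycle b.succ x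
    · rw [← cycleSize_congr hb, h2]
      exact he
    · rcases insertPair_cases b x with rfl | rfl | ⟨y, rfl⟩
      · exact absurd (SameCycle.refl _ _) hx
      · exact absurd (SameCycle.refl _ _) hb
      · have hy := (not_congr (sameCycle_insertPair_iff h1 y)).1 (not_or.2 ⟨hx, hb⟩)
        rw [cycleSize_insertPair_of_not h1 hy]
        exact hg.other y hy
  · rw [insertPair_zero, h2]

theorem admissible_of_insertPair {b : Fin (n + 2)} {g : Perm (Fin (n + 1))}
    (hi : Function.Involutive g)
    (hg : Admissible P (n + 2) (m + 1) (d + 1) (insertPair b g))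
    (he : cycleSize (finRotate (n + 3) * insertPair b g) (insertPair b g 0) = e + 1) :
    P (e + 1) ∧ b = pairPlace g e ∧ Admissible P n m (d + e) g := by
  have h1 := hg.planar.not_sameCycle hg.involutive (a := 0) (by simp)
  rw [insertPair_zero] at h1 he
  have h3 := cycleSize_insertPair_zero h1
  rw [he, hg.root] at h3
  refine ⟨?_, eq_pairPlace h1 he, hi, ?_, ?_, by omega, fun y hy => ?_⟩
  · rw [← he]
    exact hg.other _ h1
  · have := hg.numMoved_eq
    rw [numMoved_insertPair hi] at this
    omega
  · have := hg.numCycles_eq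
    rw [numCycles_insertPair h1] at this
    omega
  · rw [← cycleSize_insertPair_of_not h1 hy]
    exact hg.other _ fun e => hy ((sameCycle_insertPair_iff h1 y).1 (Or.inl e))

/-- Deleting the chord at `0` fuses faces of sizes `d + 1` and `e + 1` into a root face of size `d +
e`. The deletion is reversible because `e` prescribes where the other end goes back. -/
theorem card_admissible_pair (he : P (e + 1)) :
    Nat.card {g // Admissible P (n + 2) (m + 1) (d + 1) g ∧ g 0 ≠ 0 ∧
      cycleSize (finRotate (n + 3) * g) (g 0) = e + 1} = countAdmissible P n m (d + e) := by
  symm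
  refine Nat.card_eq_of_bijective (fun g : {g // Admissible P n m (d + e) g} =>
    ⟨insertPair (pairPlace g.1 e) g.1, (admissible_insertPair g.2 he).1, by simp,
      (admissible_insertPair g.2 he).2⟩) ⟨?_, ?_⟩
  · rintro ⟨g, hg⟩ ⟨g', hg'⟩ e
    exact Subtype.ext (insertPair_injective (congrArg Subtype.val e)).2
  · rintro ⟨g, hg, h0, he⟩
    obtain ⟨b, g', hi, rfl⟩ := exists_insertPair hg.involutive h0
    obtain ⟨_, rfl, h2⟩ := admissible_of_insertPair hi hg he
    exact ⟨⟨g', h2⟩, rfl⟩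

theorem countAdmissible_eq_add :
    countAdmissible P n m d = Nat.card {g : Perm (Fin (n + 1)) // Admissible P n m d g ∧ g 0 = 0} +
      Nat.card {g : Perm (Fin (n + 1)) // Admissible P n m d g ∧ g 0 ≠ 0} := by
  classical
  rw [countAdmissible, ← Nat.card_sum]
  exact Nat.card_congr ((Equiv.sumCompl fun g : {g // Admissible P n m d g} => g.1 0 = 0).symm.trans
    (Equiv.sumCongr (Equiv.subtypeSubtypeEquivSubtypeInter _ fun g : Perm (Fin (n + 1)) => g 0 = 0)
      (Equiv.subtypeSubtypeEquivSubtypeInter _ fun g : Perm (Fin (n + 1)) => g 0 ≠ 0)))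

end Counting

end PermCycle

/-! ### Ballot numbers and the enumeration of noncrossing diagrams. -/

namespace PermCycle

/-- The number of sequences of `d` binary trees with `m` inner nodes altogether. -/
def forestCount : ℕ → ℕ → ℕ
  | 0, 0 => 1
  | 0, _ + 1 => 0
  | d + 1, 0 => forestCount d 0
  | d + 1, m + 1 => forestCount d (m + 1) + forestCount (d + 2) m
termination_by d m => 2 * m + d

@[simp] theorem forestCount_zero_succ (m : ℕ) : forestCount 0 (m + 1) = 0 := by rw [forestCount]

theorem forestCount_succ_succ (d m : ℕ) :
    forestCount (d + 1) (m + 1) = forestCount d (m + 1) + forestCount (d + 2) m := by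
  rw [forestCount]

@[simp] theorem forestCount_zero_right (d : ℕ) : forestCount d 0 = 1 := by
  induction d with
  | zero => rw [forestCount]
  | succ d ih => rw [forestCount, ih]

/-- The ballot formula `forestCount d m = d / (2m + d) * binom (2m + d) m`, with `d + 1` in place of
`d` and denominators cleared so that induction stays in `ℕ`. -/
theorem forestCount_mul_factorial : ∀ d m : ℕ,
    forestCount (d + 1) m * (m.factorial * (m + d + 1).factorial) =
      (d + 1) * (2 * m + d).factorial
  | d, 0 => by simp [Nat.factorial_succ]
  | 0, m + 1 => by
    have h := forestCount_mul_factorial 1 m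
    rw [forestCount_succ_succ, forestCount_zero_succ, zero_add]
    calc _ = forestCount 2 m * (m.factorial * (m + 1 + 1).factorial) * (m + 1) := by
          rw [Nat.factorial_succ m]; ring
      _ = _ := by
          rw [h, show 2 * (m + 1) + 0 = (2 * m + 1) + 1 by ring, Nat.factorial_succ (2 * m + 1)]
          ring
  | d + 1, m + 1 => by
    have h := forestCount_mul_factorial d (m + 1)
    have h' := forestCount_mul_factorial (d + 2) m
    rw [forestCount_succ_succ]
    calc _ = forestCount (d + 1) (m + 1) * ((m + 1).factorial * (m + 1 + d + 1).factorial) *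
              (m + d + 3) +
            forestCount (d + 2 + 1) m * (m.factorial * (m + (d + 2) + 1).factorial) * (m + 1) := by
          rw [show m + 1 + (d + 1) + 1 = (m + d + 2) + 1 by ring,
            show m + (d + 2) + 1 = (m + d + 2) + 1 by ring,
            show m + 1 + d + 1 = m + d + 2 by ring, Nat.factorial_succ (m + d + 2),
            Nat.factorial_succ m]
          ring
      _ = _ := by
          rw [h, h', show 2 * (m + 1) + (d + 1) = (2 * m + d + 2) + 1 by ring,
            show 2 * (m + 1) + d = 2 * m + d + 2 by ring,
            show 2 * m + (d + 2) = 2 * m + d + 2 by ring, Nat.factorial_succ (2 * m + d + 2)]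
          ring
termination_by d m => 2 * m + d

theorem card_eq_sum_card_fiber {X : Type*} [Finite X] {p : X → Prop} {f : X → ℕ} {L : ℕ}
    (h : ∀ x, p x → f x < L) :
    Nat.card {x // p x} = ∑ e ∈ Finset.range L, Nat.card {x // p x ∧ f x = e} := by
  classical
  have := Fintype.ofFinite X
  simp only [Nat.card_eq_fintype_card, Fintype.card_subtype]
  rw [Finset.card_eq_sum_card_fiberwise (f := f) (t := Finset.range L)]
  · simp only [Finset.filter_filter]
  · intro x hx
    simpa using h x (by simpa using hx)

section Counting

variable {P : ℕ → Prop} {n m d e : ℕ}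

theorem Admissible.not_sameCycle {g : Perm (Fin (n + 1))} (h : Admissible P n m d g)
    (h0 : g 0 ≠ 0) : ¬ (finRotate (n + 1) * g).SameCycle 0 (g 0) :=
  h.planar.not_sameCycle h.involutive h0

theorem countAdmissible_zero_right : countAdmissible P n m 0 = 0 := by
  have : IsEmpty {g : Perm (Fin (n + 1)) // Admissible P n m 0 g} :=
    ⟨fun g => (cycleSize_pos _ _).ne' g.2.root⟩
  exact Nat.card_of_isEmpty

theorem countAdmissible_fin_one : countAdmissible P 0 0 1 = 1 := by
  have hs : Subsingleton (Fin (0 + 1)) := inferInstanceAs (Subsingleton (Fin 1))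
  have h : Admissible P 0 0 1 1 := by
    refine ⟨fun _ => rfl, by simp [numMoved], ?_, ?_, ?_⟩
    · rw [mul_one, numCycles_finRotate]
    · have : Unique {y : Fin 1 // (finRotate 1 * 1).SameCycle 0 y} :=
        ⟨⟨⟨0, SameCycle.refl _ _⟩⟩, fun _ => Subsingleton.elim _ _⟩
      exact Nat.card_unique
    · intro x hx
      exact absurd (Subsingleton.elim 0 x ▸ SameCycle.refl _ 0) hx
  have : Unique {g : Perm (Fin (0 + 1)) // Admissible P 0 0 1 g} :=
    ⟨⟨⟨1, h⟩⟩, fun _ => Subsingleton.elim _ _⟩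
  exact Nat.card_unique

/-- Either `0` is unmatched, or its chord bounds a triangle on the far side; in the latter case `e =
2` and the root face grows from `d + 1` to `d + 2`. This is the recurrence of `forestCount`, where
the first tree is a leaf or loses its root. -/
theorem countAdmissible_three : ∀ n m d, n + 1 = d + 3 * m →
    countAdmissible (· = 3) n m d = forestCount d m := by
  intro n
  induction n using Nat.strong_induction_on with | _ n ih
  intro m d hn
  rcases d with _ | d
  · rw [countAdmissible_zero_right]
    obtain ⟨m, rfl⟩ : ∃ k, m = k + 1 := ⟨m - 1, by omega⟩
    simp
  rcases m with _ | m
  · rw [forestCount_zero_right]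
    rcases n with _ | n
    · obtain rfl : d = 0 := by omega
      exact countAdmissible_fin_one
    · have : IsEmpty {g : Perm (Fin (n + 1 + 1)) //
          Admissible (· = 3) (n + 1) 0 (d + 1) g ∧ g 0 ≠ 0} := by
        refine ⟨fun g => g.2.2 ?_⟩
        rw [numMoved_eq_zero_iff.1 g.2.1.numMoved_eq, Perm.one_apply]
      rw [countAdmissible_eq_add, card_admissible_zero_fixed, ih n (by omega) 0 d (by omega),
        Nat.card_of_isEmpty, forestCount_zero_right]
  · obtain ⟨n, rfl⟩ : ∃ k, n = k + 2 := ⟨n - 2, by omega⟩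
    have h : Nat.card {g : Perm (Fin (n + 2 + 1)) //
        Admissible (· = 3) (n + 2) (m + 1) (d + 1) g ∧ g 0 ≠ 0} =
        countAdmissible (· = 3) n m (d + 2) := by
      rw [← card_admissible_pair (P := (· = 3)) (e := 2) rfl]
      refine Nat.card_congr (Equiv.subtypeEquivRight fun g => and_congr_right fun h => ?_)
      exact ⟨fun h0 => ⟨h0, h.other _ (h.not_sameCycle h0)⟩, And.left⟩
    rw [countAdmissible_eq_add, card_admissible_zero_fixed, h, ih (n + 1) (by omega) _ _ (by omega),
      ih n (by omega) _ _ (by omega), forestCount_succ_succ]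

/-- The sum started at `d` is its first term plus the sum started at `d + 1`, and the recurrence of
`forestCount` absorbs that term. The condition on `L` makes the range reach past all nonzero terms.
-/
theorem sum_forestCount (k : ℕ) : ∀ L d, k + 2 ≤ L + d →
    (∑ e ∈ Finset.range L,
      if d + e ≤ k + 1 then forestCount (d + e) (k + 1 - (d + e)) else 0) =
      if d ≤ k + 1 then forestCount (d + 1) (k + 1 - d) else 0
  | 0, d, h => by rw [Finset.sum_range_zero, if_neg (by omega)]
  | L + 1, d, h => by
    rw [Finset.sum_range_succ']
    have := sum_forestCount k L (d + 1) (by omega)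
    simp only [add_assoc d, add_comm 1, add_zero] at this ⊢
    rw [this]
    by_cases h1 : d ≤ k
    · obtain ⟨m, rfl⟩ := Nat.exists_eq_add_of_le h1
      rw [if_pos (by omega), if_pos (by omega), if_pos (by omega),
        show d + m + 1 - (d + 1) = m by omega, show d + m + 1 - d = m + 1 by omega,
        forestCount_succ_succ, add_comm]
    · by_cases h2 : d = k + 1
      · subst h2
        simp
      · rw [if_neg (by omega), if_neg (by omega), if_neg (by omega)]

theorem cycleSize_le_card {X : Type*} [Finite X] (f : Perm X) (x : X) :
    cycleSize f x ≤ Nat.card X :=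
  Nat.card_le_card_of_injective _ Subtype.val_injective

theorem apply_ne_of_numMoved_eq {X : Type*} [Finite X] {g : Perm X} (h : numMoved g = Nat.card X)
    (x : X) : g x ≠ x := by
  have h1 : {x | g x ≠ x} = Set.univ := Set.eq_of_subset_of_ncard_le (Set.subset_univ _)
    (by rw [Set.ncard_univ, ← h]; rfl)
  exact Set.eq_univ_iff_forall.1 h1 x

theorem countAdmissible_fin_two :
    countAdmissible (fun _ => True) 1 1 d = if d = 1 then 1 else 0 := by
  have hf : finRotate (1 + 1) * swap 0 1 = 1 := by decide
  have hone : cycleSize (1 : Perm (Fin (1 + 1))) 0 = 1 := by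
    simp [cycleSize]
  have h : ∀ g : Perm (Fin (1 + 1)),
      Admissible (fun _ => True) 1 1 d g ↔ g = swap 0 1 ∧ d = 1 := by
    intro g
    constructor
    · intro hg
      have h1 := apply_ne_of_numMoved_eq (by rw [hg.numMoved_eq]; simp) 
      have h2 : g = swap 0 1 := by
        have h3 : ∀ g : Perm (Fin (1 + 1)), (∀ x, g x ≠ x) → g = swap 0 1 := by decide
        exact h3 g h1
      refine ⟨h2, ?_⟩
      rw [← hg.root, h2, hf, hone]
    · rintro ⟨rfl, rfl⟩
      refine ⟨fun x => swap_apply_self _ _ _ , ?_, ?_, ?_, fun _ _ => trivial⟩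
      · have : ∀ x : Fin (1 + 1), swap 0 1 x ≠ x := by decide
        simp [numMoved, this]
      · rw [hf]
        have h1 : Nat.card (Quotient (SameCycle.setoid (1 : Perm (Fin (1 + 1))))) =
            Nat.card (Fin (1 + 1)) := by
          refine (Nat.card_eq_of_bijective (Quotient.mk _) ⟨fun x y h => ?_, Quotient.mk_surjective⟩).symm
          exact sameCycle_one.1 (Quotient.exact h)
        rw [numCycles, h1, Nat.card_fin]
      · rw [hf, hone]
  unfold countAdmissible
  simp only [h]
  split_ifs with hd
  · simp [hd]
  · simp [hd]

/-- Face sizes are now free, so the chord at `0` gives a sum over all `e`, which `sum_forestCount`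
evaluates. The ballot numbers refine the Catalan numbers by the size of the root face. -/
theorem countAdmissible_matching (k : ℕ) : ∀ d,
    countAdmissible (fun _ => True) (2 * k + 1) (k + 1) d =
      if d ≤ k + 1 then forestCount d (k + 1 - d) else 0 := by
  induction k with
  | zero =>
    intro d
    rw [mul_zero, zero_add, countAdmissible_fin_two]
    rcases d with _ | _ | d <;> simp
  | succ k ih =>
    intro d
    rcases d with _ | d
    · rw [countAdmissible_zero_right, if_pos (by omega), Nat.sub_zero, forestCount_zero_succ]
    have h1 : ∀ g : Perm (Fin (2 * k + 1 + 2 + 1)),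
        Admissible (fun _ => True) (2 * k + 1 + 2) (k + 1 + 1) (d + 1) g → g 0 ≠ 0 := by
      intro g hg
      refine apply_ne_of_numMoved_eq ?_ 0
      rw [hg.numMoved_eq, Nat.card_fin]
      ring
    rw [show 2 * (k + 1) + 1 = 2 * k + 1 + 2 by ring, countAdmissible,
      card_eq_sum_card_fiber (L := 2 * k + 1 + 2 + 1)
        (f := fun g => cycleSize (finRotate (2 * k + 1 + 3) * g) (g 0) - 1)]
    · have h2 : ∀ e, Nat.card {g : Perm (Fin (2 * k + 1 + 2 + 1)) //
          Admissible (fun _ => True) (2 * k + 1 + 2) (k + 1 + 1) (d + 1) g ∧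
            cycleSize (finRotate (2 * k + 1 + 3) * g) (g 0) - 1 = e} =
          if d + e ≤ k + 1 then forestCount (d + e) (k + 1 - (d + e)) else 0 := by
        intro e
        rw [← ih, ← card_admissible_pair trivial]
        refine Nat.card_congr (Equiv.subtypeEquivRight fun g => and_congr_right fun h => ?_)
        have := cycleSize_pos (finRotate (2 * k + 1 + 3) * g) (g 0)
        exact ⟨fun h' => ⟨h1 g h, by omega⟩, fun h' => by omega⟩
      simp only [h2]
      rw [sum_forestCount k _ d (by omega)]
      simp only [add_le_add_iff_right, Nat.add_sub_add_right]
    · intro g _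
      have h2 := cycleSize_pos (finRotate (2 * k + 1 + 3) * g) (g 0)
      have h3 := cycleSize_le_card (finRotate (2 * k + 1 + 3) * g) (g 0)
      rw [Nat.card_fin] at h3
      omega

end Counting

/-! ### Noncrossing perfect matchings of a subset of the circle. -/

section Support

variable {n : ℕ}

theorem planar_insertFixed_iff {p : Fin (n + 2)} {g : Perm (Fin (n + 1))} :
    Planar (finRotate (n + 2)) (insertFixed p g) ↔ Planar (finRotate (n + 1)) g := by
  unfold Planar
  rw [numMoved_insertFixed, numCycles_finRotate, numCycles_finRotate,
    (skips_finRotate_mul p g).numCycles_eq (by simp)]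

/-- Planar matchings of the set `s` of points on a circle. -/
def IsPlanarMatching (s : Set (Fin (n + 1))) (g : Perm (Fin (n + 1))) : Prop :=
  Function.Involutive g ∧ (∀ x, g x ≠ x ↔ x ∈ s) ∧ Planar (finRotate (n + 1)) g

theorem IsPlanarMatching.numMoved_eq {s : Set (Fin (n + 1))} {g : Perm (Fin (n + 1))}
    (h : IsPlanarMatching s g) : numMoved g = s.ncard :=
  congrArg Set.ncard (Set.ext h.2.1 : {x | g x ≠ x} = s)

theorem card_isPlanarMatching_univ (k : ℕ) :
    Nat.card {g // IsPlanarMatching (Set.univ : Set (Fin (2 * k + 1 + 1))) g} =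
      forestCount 1 (k + 1) := by
  rw [card_eq_sum_card_fiber (L := 2 * k + 3)
    (f := fun g => cycleSize (finRotate (2 * k + 1 + 1) * g) 0)]
  · have h : ∀ d, Nat.card {g : Perm (Fin (2 * k + 1 + 1)) // IsPlanarMatching Set.univ g ∧
        cycleSize (finRotate (2 * k + 1 + 1) * g) 0 = d} =
        if 0 + d ≤ k + 1 then forestCount (0 + d) (k + 1 - (0 + d)) else 0 := by
      intro d
      rw [zero_add, ← countAdmissible_matching]
      refine Nat.card_congr (Equiv.subtypeEquivRight fun g => ?_)
      constructor
      · rintro ⟨h, hd⟩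
        have hm : numMoved g = 2 * (k + 1) := by
          rw [h.numMoved_eq, Set.ncard_univ, Nat.card_fin]
          ring
        exact ⟨h.1, hm, (planar_finRotate_iff hm).1 h.2.2, hd, fun _ _ => trivial⟩
      · intro h
        refine ⟨⟨h.involutive, fun x => iff_of_true ?_ trivial, h.planar⟩, h.root⟩
        refine apply_ne_of_numMoved_eq ?_ x
        rw [h.numMoved_eq, Nat.card_fin]
        ring
    simp only [h]
    rw [sum_forestCount k _ 0 (by omega), if_pos (Nat.zero_le _), Nat.sub_zero]
  · intro g _
    have h3 := cycleSize_le_card (finRotate (2 * k + 1 + 1) * g) 0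
    rw [Nat.card_fin] at h3
    omega

/-- Points outside `s` do not affect noncrossing and can be deleted one by one; only the number of
points of `s` matters. -/
theorem card_isPlanarMatching : ∀ (n : ℕ) (s : Set (Fin (n + 1))) (k : ℕ), s.ncard = 2 * k →
    Nat.card {g // IsPlanarMatching s g} = forestCount 1 k := by
  intro n
  induction n with
  | zero =>
    intro s k hk
    have hs : Subsingleton (Fin (0 + 1)) := inferInstanceAs (Subsingleton (Fin 1))
    have h1 := Set.ncard_le_card s
    rw [Nat.card_fin] at h1
    obtain rfl : k = 0 := by omega
    have h2 : s = ∅ := (Set.ncard_eq_zero s.toFinite).1 hk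
    subst h2
    have : Unique {g : Perm (Fin (0 + 1)) // IsPlanarMatching ∅ g} :=
      ⟨⟨⟨1, fun _ => rfl, by simp, by simp [Planar, numMoved]⟩⟩, fun _ => Subsingleton.elim _ _⟩
    rw [Nat.card_unique, forestCount_zero_right]
  | succ n ih =>
    intro s k hk
    by_cases hs : s = Set.univ
    · subst hs
      rw [Set.ncard_univ, Nat.card_fin] at hk
      obtain ⟨k, rfl⟩ : ∃ j, k = j + 1 := ⟨k - 1, by omega⟩
      obtain rfl : n = 2 * k := by omega
      exact card_isPlanarMatching_univ k
    · obtain ⟨p, hp⟩ := (Set.ne_univ_iff_exists_notMem s).1 hs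
      have h1 : (p.succAbove ⁻¹' s).ncard = 2 * k := by
        rw [← hk, ← Set.ncard_image_of_injective _ (Fin.succAbove_right_injective (p := p)),
          Set.image_preimage_eq_of_subset]
        intro x hx
        exact Fin.exists_succAbove_eq fun e => hp (e ▸ hx)
      rw [← ih _ k h1]
      symm
      refine Nat.card_eq_of_bijective
        (fun g : {g // IsPlanarMatching (p.succAbove ⁻¹' s) g} => ⟨insertFixed p g.1,
          insertFixed_involutive_iff.2 g.2.1, fun x => ?_, planar_insertFixed_iff.2 g.2.2.2⟩)
        ⟨?_, ?_⟩
      · rcases Fin.eq_self_or_eq_succAbove p x with rfl | ⟨y, rfl⟩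
        · simp [hp]
        · simpa using g.2.2.1 y
      · rintro ⟨g, hg⟩ ⟨g', hg'⟩ e
        exact Subtype.ext (insertFixed_injective p (congrArg Subtype.val e))
      · rintro ⟨g, h1, h2, h3⟩
        obtain ⟨g', rfl⟩ := exists_insertFixed (not_not.1 ((not_congr (h2 p)).2 hp))
        refine ⟨⟨g', insertFixed_involutive_iff.1 h1, fun y => ?_,
          planar_insertFixed_iff.1 h3⟩, rfl⟩
        simpa using h2 (p.succAbove y)

end Support

end PermCycle

/-! ### Pairs of complementary noncrossing matchings. -/

namespace PermCycle

section Codes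

variable {X Y : Type*}

/-- The data of a tree-rooted near-triangulation with set of darts `X`: `f` is the tour of the
tree, `r` the root, `a` and `b` exchange the darts of the edges in the tree and off the tree. -/
structure IsTreeCode (f : Perm X) (r : X) (i d : ℕ) (a b : Perm X) : Prop where
  inv_left : Function.Involutive a
  inv_right : Function.Involutive b
  compl : ∀ x, a x = x ↔ b x ≠ x
  planar_left : Planar f a
  planar_right : Planar f b
  numMoved_left : numMoved a = 2 * i
  root : cycleSize (f * b) r = d
  other : ∀ x, ¬ (f * b).SameCycle r x → cycleSize (f * b) x = 3

theorem card_eq_of_cycleSize [Finite X] {f : Perm X} {r : X} {c : ℕ}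
    (h : ∀ x, ¬ f.SameCycle r x → cycleSize f x = c) :
    Nat.card X + c = cycleSize f r + c * numCycles f := by
  classical
  let s := SameCycle.setoid f
  have := Fintype.ofFinite (Quotient s)
  have h1 : ∀ x, Nat.card {y : X // (Quotient.mk s y) = Quotient.mk s x} = cycleSize f x := fun x =>
    Nat.card_congr (Equiv.subtypeEquivRight fun y =>
      ⟨fun e => SameCycle.symm (Quotient.exact e), fun e => Quotient.sound (SameCycle.symm e)⟩)
  have h2 : Nat.card X = ∑ q : Quotient s, Nat.card {y : X // Quotient.mk s y = q} := by
    rw [← Nat.card_sigma]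
    exact Nat.card_congr (Equiv.sigmaFiberEquiv (Quotient.mk s)).symm
  have h3 : ∀ q ∈ Finset.univ.erase (Quotient.mk s r),
      Nat.card {y : X // Quotient.mk s y = q} = c := by
    intro q hq
    induction q using Quotient.inductionOn with | _ x
    rw [h1]
    exact h x fun e => (Finset.ne_of_mem_erase hq) (Quotient.sound (SameCycle.symm e))
  rw [h2, ← Finset.add_sum_erase _ _ (Finset.mem_univ (Quotient.mk s r)), h1,
    Finset.sum_congr rfl h3, Finset.sum_const, Finset.card_erase_of_mem (Finset.mem_univ _),
    Finset.card_univ, ← Nat.card_eq_fintype_card, numCycles, smul_eq_mul]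
  have : 0 < Nat.card (Quotient s) :=
    have : Nonempty (Quotient s) := ⟨Quotient.mk s r⟩
    Nat.card_pos
  obtain ⟨k, hk⟩ := Nat.exists_eq_succ_of_ne_zero this.ne'
  rw [hk]
  simp only [Nat.succ_eq_add_one, Nat.add_sub_cancel]
  ring

theorem numMoved_add_numMoved [Finite X] {a b : Perm X} (h : ∀ x, a x = x ↔ b x ≠ x) :
    numMoved a + numMoved b = Nat.card X := by
  have h1 : numMoved b = ({x | a x ≠ x}ᶜ : Set X).ncard := by
    refine congrArg Set.ncard (Set.ext fun x => ?_)
    change b x ≠ x ↔ ¬ a x ≠ x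
    rw [not_not, h x]
  rw [h1]
  exact Set.ncard_add_ncard_compl _

/-- With `m` chords in `b` there are `2i + 2m` points and `m + 1` faces, one of size `d` and `m` of
size 3. Hence `2i + 2m = d + 3m`, so `m = 2i - d`. -/
theorem IsTreeCode.card_eq [Finite X] {f : Perm X} {r : X} {i d : ℕ} {a b : Perm X}
    (h : IsTreeCode f r i d a b) (hf : numCycles f = 1) :
    d ≤ 2 * i ∧ Nat.card X + 2 * d = 6 * i ∧ numMoved b = 2 * (2 * i - d) := by
  have h1 := numMoved_add_numMoved h.compl
  have h2 := card_eq_of_cycleSize h.other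
  have h3 := h.planar_right
  have h4 := h.numMoved_left
  rw [h.root] at h2
  unfold Planar at h3
  omega

section Transport

variable {e : X ≃ Y} {f : Perm X} {f' : Perm Y}

theorem numMoved_equiv (h : ∀ x, e (f x) = f' (e x)) : numMoved f' = numMoved f :=
  (Nat.card_congr (e.subtypeEquiv fun x => by rw [← h, ne_eq, ne_eq, e.apply_eq_iff_eq])).symm

variable [Finite X] [Finite Y]

theorem sameCycle_equiv_iff (h : ∀ x, e (f x) = f' (e x)) {x y : X} :
    f'.SameCycle (e x) (e y) ↔ f.SameCycle x y := by
  constructor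
  · intro hxy
    have := rel_of_sameCycle (f := f') (r := fun u v => f.SameCycle (e.symm u) (e.symm v))
      ⟨fun _ => SameCycle.refl _ _, fun h => h.symm, fun h h' => h.trans h'⟩ (fun u => ?_) hxy
    · simpa using this
    · rw [← e.apply_symm_apply u, ← h]
      simp [sameCycle_apply_right, SameCycle.refl]
  · exact rel_of_sameCycle (f := f) (r := fun u v => f'.SameCycle (e u) (e v))
      ⟨fun _ => SameCycle.refl _ _, fun h => h.symm, fun h h' => h.trans h'⟩
      (fun u => by rw [h, sameCycle_apply_right])

theorem cycleSize_equiv (h : ∀ x, e (f x) = f' (e x)) (x : X) :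
    cycleSize f' (e x) = cycleSize f x :=
  (Nat.card_congr (e.subtypeEquiv fun _ => (sameCycle_equiv_iff h).symm)).symm

theorem numCycles_equiv (h : ∀ x, e (f x) = f' (e x)) : numCycles f' = numCycles f :=
  (Nat.card_congr (Quotient.congr e fun _ _ => (sameCycle_equiv_iff h).symm)).symm

theorem IsTreeCode.transport {r : X} {i d : ℕ} {a b : Perm X} (hc : IsTreeCode f r i d a b)
    (h : ∀ x, e (f x) = f' (e x)) :
    IsTreeCode f' (e r) i d (e.permCongr a) (e.permCongr b) := by
  have ha : ∀ x, e (a x) = e.permCongr a (e x) := fun x => by simp [permCongr_apply]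
  have hb : ∀ x, e (b x) = e.permCongr b (e x) := fun x => by simp [permCongr_apply]
  have hfa : ∀ x, e ((f * a) x) = (f' * e.permCongr a) (e x) := fun x => by
    rw [Perm.mul_apply, Perm.mul_apply, h, ha]
  have hfb : ∀ x, e ((f * b) x) = (f' * e.permCongr b) (e x) := fun x => by
    rw [Perm.mul_apply, Perm.mul_apply, h, hb]
  refine ⟨fun y => ?_, fun y => ?_, fun y => ?_, ?_, ?_, ?_, ?_, fun y hy => ?_⟩
  · simp [permCongr_apply, hc.inv_left _]
  · simp [permCongr_apply, hc.inv_right _]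
  · obtain ⟨x, rfl⟩ := e.surjective y
    rw [← ha, ← hb, e.apply_eq_iff_eq, ne_eq, e.apply_eq_iff_eq]
    exact hc.compl x
  · rw [Planar, numCycles_equiv hfa, numCycles_equiv h, numMoved_equiv ha]
    exact hc.planar_left
  · rw [Planar, numCycles_equiv hfb, numCycles_equiv h, numMoved_equiv hb]
    exact hc.planar_right
  · rw [numMoved_equiv ha, hc.numMoved_left]
  · rw [cycleSize_equiv hfb, hc.root]
  · obtain ⟨x, rfl⟩ := e.surjective y
    rw [cycleSize_equiv hfb]
    exact hc.other x fun e => hy ((sameCycle_equiv_iff hfb).2 e)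

end Transport

/-- The codes fibre over `b`, and every fibre has the same Catalan cardinality, since `b` always
fixes exactly `2i` points. -/
theorem card_isTreeCode {n i d : ℕ} (hn : n + 1 + 2 * d = 6 * i) (hd : d ≤ 2 * i) :
    Nat.card {c : Perm (Fin (n + 1)) × Perm (Fin (n + 1)) //
      IsTreeCode (finRotate (n + 1)) 0 i d c.1 c.2} =
      forestCount d (2 * i - d) * forestCount 1 i := by
  classical
  let B := {b : Perm (Fin (n + 1)) // Admissible (· = 3) n (2 * i - d) d b}
  have hfix : ∀ b : B, {x | b.1 x = x}.ncard = 2 * i := fun b => by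
    have h1 := Set.ncard_add_ncard_compl {x | b.1 x ≠ x}
    have h2 : {x | b.1 x ≠ x}.ncard = 2 * (2 * i - d) := b.2.numMoved_eq
    have h3 : {x | b.1 x = x} = {x | b.1 x ≠ x}ᶜ := by ext; simp
    rw [Nat.card_fin] at h1
    rw [h3]
    omega
  have e : {c : Perm (Fin (n + 1)) × Perm (Fin (n + 1)) //
      IsTreeCode (finRotate (n + 1)) 0 i d c.1 c.2} ≃
      Σ b : B, {a // IsPlanarMatching {x | b.1 x = x} a} :=
    { toFun := fun c => ⟨⟨c.1.2, c.2.inv_right, (c.2.card_eq (numCycles_finRotate n)).2.2,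
          (planar_finRotate_iff (c.2.card_eq (numCycles_finRotate n)).2.2).1 c.2.planar_right,
          c.2.root, c.2.other⟩, c.1.1, c.2.inv_left, fun x => by
            have := c.2.compl x
            simp only [Set.mem_ofPred_eq]
            tauto, c.2.planar_left⟩
      invFun := fun p => ⟨(p.2.1, p.1.1), p.2.2.1, p.1.2.involutive, fun x => by
          have := p.2.2.2.1 x
          simp only [Set.mem_ofPred_eq] at this
          tauto, p.2.2.2.2, p.1.2.planar, by rw [p.2.2.numMoved_eq, hfix], p.1.2.root, p.1.2.other⟩
      left_inv := fun _ => rfl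
      right_inv := fun _ => rfl }
  rw [Nat.card_congr e, Nat.card_sigma, Finset.sum_congr rfl fun b _ =>
    card_isPlanarMatching n {x | b.1 x = x} i (hfix b), Finset.sum_const, smul_eq_mul,
    Finset.card_univ, ← Nat.card_eq_fintype_card,
    ← countAdmissible_three n (2 * i - d) d (by omega)]
  rfl

end Codes

end PermCycle

/-! ### Vertices, faces and edges of a map in terms of cycles and darts. -/

namespace EmbeddedGraph

variable (M : EmbeddedGraph) {S : Set M.Dart}

theorem subgraph_adj (hS : ∀ a ∈ S, M.flip a ∈ S) {u v : M.Vertex} :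
    (M.subgraph S).Adj u v ↔ u ≠ v ∧ ∃ a ∈ S, M.origin a = u ∧ M.origin (M.flip a) = v := by
  rw [subgraph, SimpleGraph.fromRel_adj]
  refine and_congr_right fun _ => ⟨?_, Or.inl⟩
  rintro (h | ⟨a, ha, h1, h2⟩)
  · exact h
  · exact ⟨M.flip a, hS a ha, h2, by rw [M.flip_flip, h1]⟩

/-- Each oriented edge of the simple graph lifts to a dart in `S`. Equality may fail because of
loops and parallel edges in `S`. -/
theorem two_mul_card_edgeSet_le (hS : ∀ a ∈ S, M.flip a ∈ S) :
    2 * Nat.card (M.subgraph S).edgeSet ≤ S.ncard := by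
  classical
  have := M.finite_vertex
  have := M.finite_dart
  have := Fintype.ofFinite M.Vertex
  have h : ∀ p : (M.subgraph S).Dart, ∃ a ∈ S, M.origin a = p.fst ∧ M.origin (M.flip a) = p.snd :=
    fun p => ((M.subgraph_adj hS).1 p.adj).2
  choose k hk h1 h2 using h
  have h3 : Function.Injective fun p => (⟨k p, hk p⟩ : S) := by
    intro p q e
    have e : k p = k q := congrArg Subtype.val e
    refine SimpleGraph.Dart.ext _ _ (Prod.ext ?_ ?_)
    · exact (h1 p).symm.trans ((congrArg _ e).trans (h1 q))
    · exact (h2 p).symm.trans ((congrArg (fun x => M.origin (M.flip x)) e).trans (h2 q))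
  have h4 := Nat.card_le_card_of_injective _ h3
  rw [Nat.card_eq_fintype_card, SimpleGraph.dart_card_eq_twice_card_edges,
    SimpleGraph.edgeFinset_card, ← Nat.card_eq_fintype_card] at h4
  exact h4

theorem exists_vertexEquiv (r : M.Dart) : ∃ e : Quotient (SameCycle.setoid M.rot) ≃ M.Vertex,
    ∀ x, e (Quotient.mk _ x) = M.origin x := by
  refine ⟨Equiv.ofBijective (Quotient.lift (s := SameCycle.setoid M.rot) M.origin
    fun a b h => (M.origin_eq_iff a b).2 h) ⟨?_, fun v => ?_⟩, fun _ => rfl⟩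
  · intro q q' e
    induction q using Quotient.inductionOn with | _ a
    induction q' using Quotient.inductionOn with | _ b
    exact Quotient.sound ((M.origin_eq_iff a b).1 e)
  · suffices h : ∃ a, M.origin a = v by
      obtain ⟨a, rfl⟩ := h
      exact ⟨Quotient.mk _ a, rfl⟩
    by_cases h : v = M.origin r
    · exact ⟨r, h.symm⟩
    · obtain ⟨p⟩ := M.connected.preconnected v (M.origin r)
      cases p with
      | nil => exact absurd rfl h
      | cons hadj _ =>
        rw [SimpleGraph.fromRel_adj] at hadj
        rcases hadj.2 with ⟨a, ha, _⟩ | ⟨a, _, ha⟩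
        · exact ⟨a, ha⟩
        · exact ⟨_, ha⟩

theorem card_vertex_eq_numCycles (r : M.Dart) :
    M.numVertices = PermCycle.numCycles M.rot :=
  (Nat.card_congr (M.exists_vertexEquiv r).choose).symm

theorem numFaces_eq_numCycles (r : M.Dart) : M.numFaces = PermCycle.numCycles M.facePerm := by
  rw [numFaces, if_neg fun h => h.false r]
  rfl

end EmbeddedGraph

open PermCycle

/-! ### From a code to a tree-rooted near-triangulation. -/

namespace PermCycle.IsTreeCode

theorem numCycles_tour {X : Type} [Finite X] {f : Perm X} (r : X) (hf : ∀ x y, f.SameCycle x y) :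
    numCycles f = 1 :=
  have : Nonempty X := ⟨r⟩
  numCycles_eq_one hf

variable {X : Type} {f : Perm X} {r : X} {i d : ℕ} {a b : Perm X}

theorem flip_of_fixed (h : IsTreeCode f r i d a b) {x : X} (hx : a x = x) : (a * b) x = b x := by
  rw [Perm.mul_apply, h.compl, h.inv_right]
  exact ((h.compl x).1 hx).symm

theorem flip_of_moved (h : IsTreeCode f r i d a b) {x : X} (hx : a x ≠ x) : (a * b) x = a x := by
  rw [Perm.mul_apply, not_not.1 fun e => hx ((h.compl x).2 e)]

theorem flip_flip (h : IsTreeCode f r i d a b) (x : X) : (a * b) ((a * b) x) = x := by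
  by_cases hx : a x = x
  · have hbx : a (b x) = b x := by
      rw [h.compl, h.inv_right]
      exact ((h.compl x).1 hx).symm
    rw [h.flip_of_fixed hx, h.flip_of_fixed hbx, h.inv_right]
  · rw [h.flip_of_moved hx, h.flip_of_moved fun e => hx (a.injective e), h.inv_left]

theorem flip_ne (h : IsTreeCode f r i d a b) (x : X) : (a * b) x ≠ x := by
  by_cases hx : a x = x
  · rw [h.flip_of_fixed hx]
    exact (h.compl x).1 hx
  · rwa [h.flip_of_moved hx]

theorem mul_flip (h : IsTreeCode f r i d a b) : f * a * (a * b) = f * b := by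
  have : a * a = 1 := Equiv.ext h.inv_left
  rw [mul_assoc, ← mul_assoc a, this, one_mul]

variable [Finite X]

/-- The relation of being joined by a chain of tree edges. -/
theorem reachable_of_step {V : Type} {G : SimpleGraph V} {o : X → V} {g : Perm X}
    (h : ∀ x, G.Reachable (o x) (o (g x))) {x y : X} (hxy : g.SameCycle x y) :
    G.Reachable (o x) (o y) :=
  rel_of_sameCycle (r := fun x y => G.Reachable (o x) (o y))
    ⟨fun _ => SimpleGraph.Reachable.refl _, fun h => h.symm, fun h h' => h.trans h'⟩ h hxy

/-- Since `(f * a) (a z) = f z`, each step of the tour stays at the vertex of `z` or crosses the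
tree edge of `z`. The tour visits all darts, so tree edges alone connect all vertices. -/
theorem reachable (h : IsTreeCode f r i d a b) (hf : ∀ x y, f.SameCycle x y)
    {G : SimpleGraph (Quotient (SameCycle.setoid (f * a)))}
    (hG : ∀ x, a x ≠ x → Quotient.mk (SameCycle.setoid (f * a)) x ≠ Quotient.mk _ (a x) →
      G.Adj (Quotient.mk _ x) (Quotient.mk _ (a x))) : G.Connected := by
  have : Nonempty (Quotient (SameCycle.setoid (f * a))) := ⟨Quotient.mk _ r⟩
  refine ⟨fun u v => ?_⟩
  induction u using Quotient.inductionOn with | _ x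
  induction v using Quotient.inductionOn with | _ y
  refine reachable_of_step (fun z => ?_) (hf x y)
  have h1 : Quotient.mk (SameCycle.setoid (f * a)) (f z) = Quotient.mk _ (a z) :=
    Quotient.sound (SameCycle.symm ⟨1, by rw [zpow_one, Perm.mul_apply, h.inv_left]⟩)
  rw [h1]
  by_cases hz : a z = z
  · rw [hz]
  by_cases hz' : Quotient.mk (SameCycle.setoid (f * a)) z = Quotient.mk _ (a z)
  · rw [← hz']
  · exact (hG z hz hz').reachable

/-- The embedded graph with tour `f`, tree edges given by `a` and other edges given by `b`. -/
def toEmbeddedGraph (h : IsTreeCode f r i d a b) (hf : ∀ x y, f.SameCycle x y) :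
    EmbeddedGraph where
  Vertex := Quotient (SameCycle.setoid (f * a))
  Dart := X
  finite_vertex := inferInstance
  finite_dart := inferInstance
  origin := Quotient.mk _
  flip := a * b
  rot := f * a
  flip_flip := h.flip_flip
  flip_ne := h.flip_ne
  origin_eq_iff x y := Quotient.eq
  connected := h.reachable hf fun x hx hne => by
    rw [SimpleGraph.fromRel_adj]
    exact ⟨hne, Or.inl ⟨x, rfl, by rw [h.flip_of_moved hx]⟩⟩

theorem numVertices_toEmbeddedGraph (h : IsTreeCode f r i d a b) (hf : ∀ x y, f.SameCycle x y) :
    (h.toEmbeddedGraph hf).numVertices = i + 1 := by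
  have h1 := h.planar_left
  rw [Planar, h.numMoved_left, numCycles_tour r hf] at h1
  have h2 : (h.toEmbeddedGraph hf).numVertices = numCycles (f * a) := rfl
  omega

variable [DecidableEq X]

theorem not_sameCycle (h : IsTreeCode f r i d a b) {x : X} (hx : a x ≠ x) :
    ¬ (f * a).SameCycle x (a x) :=
  h.planar_left.not_sameCycle h.inv_left hx

/-- Planarity survives the removal of the pair of `x`, which merges the two end vertices of `x`. A
parallel chord `y` would then have both ends in one cycle. -/
theorem eq_of_parallel (h : IsTreeCode f r i d a b) {x y : X} (hx : a x ≠ x) (hy : a y ≠ y)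
    (hxy : (f * a).SameCycle x y) (hxy' : (f * a).SameCycle (a x) (a y)) : x = y := by
  by_contra hne
  have h1 : y ≠ a x := fun e => h.not_sameCycle hx (e ▸ hxy)
  have h2 := unpair_apply_of_ne (Ne.symm hne) h1
  have h3 := (h.planar_left.unpair h.inv_left hx).not_sameCycle (unpair_involutive h.inv_left x)
    (a := y) (by rwa [h2])
  rw [h2, unpair, ← mul_assoc, sameCycle_mul_swap_iff (h.not_sameCycle hx)] at h3
  exact h3 (Or.inr ⟨Or.inl hxy, Or.inr hxy'⟩)

theorem isSpanningTree (h : IsTreeCode f r i d a b) (hf : ∀ x y, f.SameCycle x y)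
    {S : Set (h.toEmbeddedGraph hf).Dart} (hS : ∀ x : X, x ∈ S ↔ a x ≠ x) :
    (h.toEmbeddedGraph hf).IsSpanningTree S := by
  have hflip : ∀ x : X, a x ≠ x → (h.toEmbeddedGraph hf).flip x = a x :=
    fun x hx => h.flip_of_moved hx
  have hor : ∀ x y : X, (h.toEmbeddedGraph hf).origin x = (h.toEmbeddedGraph hf).origin y ↔
      (f * a).SameCycle x y := fun x y => Quotient.eq
  have hmem : ∀ x ∈ S, (h.toEmbeddedGraph hf).flip x ∈ S :=
    fun x hx => by
      have hx := (hS x).1 hx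
      rw [hflip x hx]
      exact (hS _).2 fun e => hx (a.injective e)
  refine ⟨hmem, fun x hx => ?_, fun x hx y hy hxy hxy' => ?_, ?_⟩
  · have hx := (hS x).1 hx
    rw [hflip x hx]
    exact fun e => h.not_sameCycle hx ((hor _ _).1 e)
  · have hx := (hS x).1 hx
    have hy := (hS y).1 hy
    rw [hflip x hx, hflip y hy] at hxy'
    exact h.eq_of_parallel hx hy ((hor _ _).1 hxy) ((hor _ _).1 hxy')
  · have hconn : ((h.toEmbeddedGraph hf).subgraph S).Connected :=
      h.reachable hf fun x hx hne => by
        refine ((h.toEmbeddedGraph hf).subgraph_adj hmem).2 ⟨hne, x, (hS x).2 hx, rfl, ?_⟩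
        rw [hflip x hx]
        rfl
    have := (h.toEmbeddedGraph hf).finite_vertex
    refine SimpleGraph.isTree_iff_connected_and_card.2 ⟨hconn, ?_⟩
    -- There are at most `i` edges by counting darts, and at least `i` because the graph is
    -- connected on `i + 1` vertices.
    have h1 := (h.toEmbeddedGraph hf).two_mul_card_edgeSet_le hmem
    have h2 := hconn.card_vert_le_card_edgeSet_add_one
    have h3 : S.ncard = 2 * i := by
      rw [← h.numMoved_left]
      exact congrArg Set.ncard (Set.ext hS)
    have h4 := h.numVertices_toEmbeddedGraph hf
    unfold EmbeddedGraph.numVertices at h4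
    omega

/-- The tree-rooted near-triangulation with tour `f`, tree edges given by `a` and other edges given
by `b`. -/
def toRep (h : IsTreeCode f r i d a b) (hf : ∀ x y, f.SameCycle x y) : TreeRootedRep where
  toEmbeddedGraph := h.toEmbeddedGraph hf
  euler := by
    have h1 := h.numVertices_toEmbeddedGraph hf
    have h2 : (h.toEmbeddedGraph hf).numFaces = numCycles (f * b) := by
      rw [EmbeddedGraph.numFaces_eq_numCycles _ (show (h.toEmbeddedGraph hf).Dart from r),
        ← h.mul_flip]
      rfl
    have h3 : (h.toEmbeddedGraph hf).numEdges = Nat.card X / 2 := rfl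
    have h4 := h.planar_right
    have h5 := numMoved_add_numMoved h.compl
    have h6 := h.numMoved_left
    have h7 := numCycles_tour r hf
    unfold Planar at h4
    omega
  root := some r
  root_eq_none h := by simp at h
  isNearTriangulation := by
    rintro r' hr x hx
    obtain rfl : r = r' := Option.some.inj hr
    have h1 : (h.toEmbeddedGraph hf).facePerm = f * b := h.mul_flip
    change ¬ (h.toEmbeddedGraph hf).facePerm.SameCycle r x at hx
    change Nat.card {y : X // (h.toEmbeddedGraph hf).facePerm.SameCycle x y} = 3
    rw [h1] at hx ⊢
    exact h.other x hx
  tree := {x | a x ≠ x}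
  isSpanningTree := h.isSpanningTree hf fun _ => Iff.rfl

theorem outerDegree_toRep (h : IsTreeCode f r i d a b) (hf : ∀ x y, f.SameCycle x y) :
    (h.toRep hf).outerDegree = d := by
  change Nat.card {y : X // (h.toEmbeddedGraph hf).facePerm.SameCycle r y} = d
  have h1 : (h.toEmbeddedGraph hf).facePerm = f * b := h.mul_flip
  rw [h1]
  exact h.root

end PermCycle.IsTreeCode

namespace PermCycle

theorem even_numMoved {X : Type*} [DecidableEq X] [Finite X] {g : Perm X}
    (hg : Function.Involutive g) : Even (numMoved g) := by
  induction hn : numMoved g using Nat.strong_induction_on generalizing g with | _ n ih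
  by_cases h1 : g = 1
  · rw [← hn, numMoved_eq_zero_iff.2 h1]
    exact Even.zero
  obtain ⟨a, ha⟩ : ∃ a, g a ≠ a := by
    by_contra! h
    exact h1 (Equiv.ext h)
  have h2 := numMoved_eq_unpair_add_two hg ha
  rw [← hn, h2]
  exact (ih _ (by omega) (unpair_involutive hg a) rfl).add even_two

theorem sameCycle_of_numCycles_eq_one {X : Type*} {f : Perm X} (h : numCycles f = 1) (x y : X) :
    f.SameCycle x y := by
  rw [numCycles, Nat.card_eq_one_iff_unique] at h
  exact Quotient.exact (h.1.elim (Quotient.mk (SameCycle.setoid f) x) (Quotient.mk _ y))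

end PermCycle

/-! ### From a map with a spanning tree to its code. -/

namespace EmbeddedGraph

variable (M : EmbeddedGraph) {S : Set M.Dart}

open Classical in
/-- The involution that exchanges the darts of the edges in `S`. -/
noncomputable def flipOn (S : Set M.Dart) (hS : ∀ x ∈ S, M.flip x ∈ S) : Perm M.Dart :=
  Function.Involutive.toPerm (fun x => if x ∈ S then M.flip x else x) fun x => by
    by_cases h : x ∈ S
    · simp [h, hS x h, M.flip_flip]
    · simp [h]

variable {M}

theorem flipOn_of_mem (hS : ∀ x ∈ S, M.flip x ∈ S) {x : M.Dart} (hx : x ∈ S) :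
    M.flipOn S hS x = M.flip x := if_pos hx

theorem flipOn_of_notMem (hS : ∀ x ∈ S, M.flip x ∈ S) {x : M.Dart} (hx : x ∉ S) :
    M.flipOn S hS x = x := if_neg hx

theorem flipOn_involutive (hS : ∀ x ∈ S, M.flip x ∈ S) : Function.Involutive (M.flipOn S hS) :=
  (M.flipOn S hS).symm_apply_apply

theorem flipOn_ne_iff (hS : ∀ x ∈ S, M.flip x ∈ S) {x : M.Dart} :
    M.flipOn S hS x ≠ x ↔ x ∈ S := by
  by_cases hx : x ∈ S
  · simp [flipOn_of_mem hS hx, hx, M.flip_ne]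
  · simp [flipOn_of_notMem hS hx, hx]

theorem flip_mem_compl (hS : ∀ x ∈ S, M.flip x ∈ S) : ∀ x ∈ Sᶜ, M.flip x ∈ Sᶜ := fun x hx h =>
  hx (by simpa [M.flip_flip] using hS _ h)

theorem flipOn_mul_flipOn_compl (hS : ∀ x ∈ S, M.flip x ∈ S) :
    M.flipOn S hS * M.flipOn Sᶜ (flip_mem_compl hS) = M.flip := by
  ext x : 1
  rw [Perm.mul_apply]
  by_cases hx : x ∈ S
  · rw [flipOn_of_notMem _ (Set.notMem_compl_iff.2 hx), flipOn_of_mem hS hx]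
  · rw [flipOn_of_mem _ (Set.mem_compl hx), flipOn_of_notMem hS (flip_mem_compl hS x hx)]

/-- When only some tree edges have been glued, a cycle of `rot * g` stays within vertices joined by
those edges. If it contained both darts of an unglued tree edge, that edge would not be a bridge of
the tree. -/
theorem IsSpanningTree.not_sameCycle (h : M.IsSpanningTree S) {g : Perm M.Dart}
    (hg : Function.Involutive g) (hsub : ∀ x, g x = x ∨ g x = M.flipOn S h.flip_mem x)
    {x : M.Dart} (hx : x ∈ S) (hgx : g x = x) : ¬ (M.rot * g).SameCycle x (M.flip x) := by
  have hmov : ∀ y, g y ≠ y → y ∈ S ∧ g y = M.flip y := fun y hy => by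
    have h1 := (hsub y).resolve_left hy
    have h2 : y ∈ S := (flipOn_ne_iff h.flip_mem).1 (h1 ▸ hy)
    exact ⟨h2, by rw [h1, flipOn_of_mem h.flip_mem h2]⟩
  intro hs
  have hor : ∀ y, M.origin (M.rot y) = M.origin y := fun y =>
    (M.origin_eq_iff _ _).2 (sameCycle_apply_left.2 (SameCycle.refl _ _))
  have := M.finite_dart
  have hbr := SimpleGraph.isAcyclic_iff_forall_isBridge.1 h.isTree.isAcyclic
    (e := s(M.origin x, M.origin (M.flip x)))
    ((M.subgraph_adj h.flip_mem).2 ⟨h.no_loop x hx, x, hx, rfl, rfl⟩)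
  rw [SimpleGraph.isBridge_iff] at hbr
  refine hbr (PermCycle.IsTreeCode.reachable_of_step (fun y => ?_) hs)
  rw [Perm.mul_apply, hor]
  by_cases hy : g y = y
  · rw [hy]
  obtain ⟨h1, h2⟩ := hmov y hy
  rw [h2]
  refine SimpleGraph.Adj.reachable ?_
  rw [SimpleGraph.deleteEdges_adj]
  refine ⟨(M.subgraph_adj h.flip_mem).2 ⟨h.no_loop y h1, y, h1, rfl, rfl⟩, fun e => ?_⟩
  rw [Set.mem_singleton_iff, Sym2.eq_iff] at e
  rcases e with ⟨e1, e2⟩ | ⟨e1, e2⟩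
  · exact hy (h.no_parallel y h1 x hx e1 e2 ▸ hgx)
  · have e3 : M.flip y = x := h.no_parallel _ (h.flip_mem y h1) x hx e2 (by rw [M.flip_flip, e1])
    rw [← e3, ← h2, hg] at hgx
    exact hy hgx.symm

/-- The permutation describing the tour around the tree. -/
noncomputable def tour (S : Set M.Dart) (hS : ∀ x ∈ S, M.flip x ∈ S) : Perm M.Dart :=
  M.rot * M.flipOn S hS

theorem tour_mul_flipOn (hS : ∀ x ∈ S, M.flip x ∈ S) :
    tour S hS * M.flipOn S hS = M.rot := by
  have : M.flipOn S hS * M.flipOn S hS = 1 := Equiv.ext (flipOn_involutive hS)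
  rw [tour, mul_assoc, this, mul_one]

theorem tour_mul_flipOn_compl (hS : ∀ x ∈ S, M.flip x ∈ S) :
    tour S hS * M.flipOn Sᶜ (flip_mem_compl hS) = M.facePerm := by
  rw [tour, mul_assoc, flipOn_mul_flipOn_compl, facePerm]

/-- Every tree edge merges two cycles, starting from one cycle of `rot` per vertex. A tree has one
edge fewer than vertices, which leaves a single cycle. -/
theorem IsSpanningTree.tour_aux (h : M.IsSpanningTree S) (r : M.Dart) :
    numCycles (tour S h.flip_mem) = 1 ∧
      numMoved (M.flipOn S h.flip_mem) + 2 = 2 * M.numVertices := by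
  classical
  have := M.finite_dart
  have := M.finite_vertex
  have h1 := two_mul_numCycles_add_numMoved (f := M.rot) (g := M.flipOn S h.flip_mem)
    (fun g hg hsub x hx hgx => by
      have hxS := (flipOn_ne_iff h.flip_mem).1 hx
      rw [flipOn_of_mem h.flip_mem hxS]
      exact h.not_sameCycle hg hsub hxS hgx) (flipOn_involutive h.flip_mem)
  have h2 := M.two_mul_card_edgeSet_le h.flip_mem
  have h3 : numMoved (M.flipOn S h.flip_mem) = S.ncard :=
    congrArg Set.ncard (Set.ext fun x => flipOn_ne_iff h.flip_mem)
  have h4 := (SimpleGraph.isTree_iff_connected_and_card.1 h.isTree).2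
  have h5 := M.card_vertex_eq_numCycles r
  have h6 : 0 < numCycles (tour S h.flip_mem) :=
    have : Nonempty (Quotient (SameCycle.setoid (tour S h.flip_mem))) := ⟨Quotient.mk _ r⟩
    Nat.card_pos
  change 2 * numCycles (tour S h.flip_mem) + _ = _ at h1
  unfold numVertices at *
  omega

end EmbeddedGraph

namespace TreeRootedRep

variable (M : TreeRootedRep)

theorem isTreeCode {r : M.Dart} (hr : M.root = some r) :
    IsTreeCode (EmbeddedGraph.tour M.tree M.isSpanningTree.flip_mem) r (M.numVertices - 1)
      M.outerDegree (M.flipOn M.tree M.isSpanningTree.flip_mem)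
      (M.flipOn M.treeᶜ (EmbeddedGraph.flip_mem_compl M.isSpanningTree.flip_mem)) := by
  classical
  have := M.finite_dart
  have hS := M.isSpanningTree.flip_mem
  obtain ⟨h1, h2⟩ := M.isSpanningTree.tour_aux r
  have h3 := M.card_vertex_eq_numCycles r
  have h4 := M.numFaces_eq_numCycles r
  have hcompl : ∀ x, M.flipOn M.tree hS x = x ↔
      M.flipOn M.treeᶜ (EmbeddedGraph.flip_mem_compl hS) x ≠ x := fun x => by
    rw [EmbeddedGraph.flipOn_ne_iff, Set.mem_compl_iff, ← EmbeddedGraph.flipOn_ne_iff hS, not_not]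
  refine ⟨EmbeddedGraph.flipOn_involutive _, EmbeddedGraph.flipOn_involutive _, hcompl, ?_, ?_, ?_,
    ?_, ?_⟩
  · rw [Planar, EmbeddedGraph.tour_mul_flipOn, h1, ← h3, ← h2]
  · have h5 := M.euler
    have h6 : M.numEdges = Nat.card M.Dart / 2 := rfl
    have h7 := numMoved_add_numMoved hcompl
    -- `numEdges` is a truncated quotient, so Euler's relation can be used only once the number of
    -- darts is known to be even.
    obtain ⟨k, hk⟩ := even_numMoved (EmbeddedGraph.flipOn_involutive hS)
    obtain ⟨l, hl⟩ := even_numMoved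
      (EmbeddedGraph.flipOn_involutive (EmbeddedGraph.flip_mem_compl hS))
    rw [Planar, EmbeddedGraph.tour_mul_flipOn_compl, h1, ← h4]
    omega
  · omega
  · rw [EmbeddedGraph.tour_mul_flipOn_compl, RootedPlanarMap.outerDegree, hr]
    rfl
  · rw [EmbeddedGraph.tour_mul_flipOn_compl]
    exact M.isNearTriangulation r hr

end TreeRootedRep

/-! ### Canonical numbering of the darts along the tour. -/

namespace PermCycle

theorem exists_equiv_fin {X : Type*} [Finite X] {f : Perm X} (hf : ∀ x y, f.SameCycle x y)
    (r : X) {n : ℕ} (hn : Nat.card X = n + 1) :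
    ∃ e : X ≃ Fin (n + 1), e r = 0 ∧ ∀ x, e (f x) = finRotate (n + 1) (e x) := by
  have hsize : cycleSize f r = n + 1 := by
    rw [← hn]
    exact Nat.card_congr (Equiv.subtypeUnivEquiv (hf r))
  have hinj : Function.Injective fun k : Fin (n + 1) => (f ^ (k : ℕ)) r := by
    intro k l hkl
    by_contra hne
    rcases lt_or_gt_of_ne hne with h | h
    · exact pow_injOn_cycleSize (Fin.lt_def.1 h) (by have := l.2; omega) hkl
    · exact pow_injOn_cycleSize (Fin.lt_def.1 h) (by have := k.2; omega) hkl.symm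
  have hbij := (Nat.bijective_iff_injective_and_card _).2 ⟨hinj, by rw [hn, Nat.card_fin]⟩
  refine ⟨(Equiv.ofBijective _ hbij).symm, ?_, fun x => ?_⟩
  · rw [Equiv.symm_apply_eq]
    simp
  · rw [Equiv.symm_apply_eq]
    obtain ⟨k, rfl⟩ := (Equiv.ofBijective _ hbij).surjective x
    rw [Equiv.symm_apply_apply]
    simp only [Equiv.ofBijective_apply, val_finRotate]
    rw [← pow_succ_apply]
    split_ifs with h
    · rw [h, ← hsize, pow_cycleSize, pow_zero, Perm.one_apply]
    · rfl

end PermCycle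

namespace PermCycle.IsTreeCode

variable {X Y : Type} [Finite X] [Finite Y] [DecidableEq X] [DecidableEq Y]
  {f : Perm X} {r : X} {g : Perm Y} {s : Y} {i d i' d' : ℕ} {a b : Perm X} {a' b' : Perm Y}

/-- The code can be recovered from the map: `a` is `flip` restricted to tree darts, and then `f` and
`b` follow from `rot = f * a` and `flip = a * b`. -/
theorem iso_apply (h : IsTreeCode f r i d a b) (hf : ∀ x y, f.SameCycle x y)
    (h' : IsTreeCode g s i' d' a' b') (hg : ∀ x y, g.SameCycle x y)
    (φ : TreeRootedRep.Iso (h.toRep hf) (h'.toRep hg)) {e : X ≃ Y}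
    (he : ∀ x : X, e x = φ.dartEquiv x) :
    e r = s ∧ (∀ x, e (f x) = g (e x)) ∧ (∀ x, a' (e x) = e (a x)) ∧
      ∀ x, b' (e x) = e (b x) := by
  have hroot : e r = s := by
    rw [he]
    exact (Option.some.inj φ.map_root).symm
  have hflip : ∀ x, (a' * b') (e x) = e ((a * b) x) := fun x => by
    rw [he, he]
    exact φ.map_flip x
  have hrot : ∀ x, (g * a') (e x) = e ((f * a) x) := fun x => by
    rw [he, he]
    exact φ.map_rot x
  have htree : ∀ x, a' (e x) ≠ e x ↔ a x ≠ x := fun x => by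
    rw [he]
    exact φ.map_tree x
  have ha : ∀ x, a' (e x) = e (a x) := fun x => by
    by_cases hx : a x = x
    · rw [hx]
      exact not_not.1 fun h1 => (htree x).1 h1 hx
    · rw [← h'.flip_of_moved ((htree x).2 hx), ← h.flip_of_moved hx, hflip]
  refine ⟨hroot, fun x => ?_, ha, fun x => ?_⟩
  · have h1 := hrot (a x)
    rwa [Perm.mul_apply, ha, Perm.mul_apply, h.inv_left, eq_comm] at h1
  · have h1 := hflip x
    rw [Perm.mul_apply, Perm.mul_apply, ← ha] at h1
    exact a'.injective h1

end PermCycle.IsTreeCode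

namespace TreeRootedNearTriangulation

variable {n i d : ℕ}

/-- The tree-rooted near-triangulation encoded by two permutations of `Fin (n + 1)`. -/
noncomputable def ofCode (c : {c : Perm (Fin (n + 1)) × Perm (Fin (n + 1)) //
    IsTreeCode (finRotate (n + 1)) 0 i d c.1 c.2}) : WithVertices (i + 1) d :=
  ⟨Quotient.mk _ (c.2.toRep sameCycle_finRotate),
    c.2.numVertices_toEmbeddedGraph sameCycle_finRotate, c.2.outerDegree_toRep sameCycle_finRotate⟩

theorem eq_refl_of_finRotate {e : Fin (n + 1) ≃ Fin (n + 1)} (h0 : e 0 = 0)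
    (h : ∀ x, e (finRotate (n + 1) x) = finRotate (n + 1) (e x)) (x : Fin (n + 1)) : e x = x :=
  mem_of_sameCycle (s := {x | e x = x}) (fun y (hy : e y = y) => by
    rw [Set.mem_ofPred_eq, h, hy]) (sameCycle_finRotate 0 x) h0

/-- An isomorphism fixes the root `0` and commutes with the rotation, hence is the identity on
darts. -/
theorem ofCode_injective : Function.Injective (ofCode (n := n) (i := i) (d := d)) := by
  rintro ⟨⟨a, b⟩, hc⟩ ⟨⟨a', b'⟩, hc'⟩ e
  obtain ⟨φ⟩ : Nonempty (TreeRootedRep.Iso _ _) := Quotient.exact (congrArg Subtype.val e)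
  obtain ⟨h0, h1, h2, h3⟩ := hc.iso_apply sameCycle_finRotate hc' sameCycle_finRotate φ
    (e := φ.dartEquiv) fun _ => rfl
  have hφ := eq_refl_of_finRotate h0 h1
  refine Subtype.ext (Prod.ext (Equiv.ext fun x => ?_) (Equiv.ext fun x => ?_))
  · have := h2 x
    rw [hφ, hφ] at this
    exact this.symm
  · have := h3 x
    rw [hφ, hφ] at this
    exact this.symm

end TreeRootedNearTriangulation

namespace TreeRootedRep

variable (M : TreeRootedRep)

theorem card_dart {r : M.Dart} (hr : M.root = some r) :
    M.outerDegree ≤ 2 * (M.numVertices - 1) ∧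
      Nat.card M.Dart + 2 * M.outerDegree = 6 * (M.numVertices - 1) := by
  have := M.finite_dart
  have := (M.isTreeCode hr).card_eq (M.isSpanningTree.tour_aux r).1
  exact ⟨this.1, this.2.1⟩

theorem iso_toRep {X : Type} [Finite X] [DecidableEq X] {f a b : Perm X} {r : X} {i d : ℕ}
    (h : IsTreeCode f r i d a b) (hf : ∀ x y, f.SameCycle x y) {r' : M.Dart}
    (hr : M.root = some r') {e : M.Dart ≃ X} (her : e r' = r)
    (hrot : ∀ x, e (M.rot x) = (f * a) (e x)) (hflip : ∀ x, e (M.flip x) = (a * b) (e x))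
    (htree : ∀ x, a (e x) ≠ e x ↔ x ∈ M.tree) : Nonempty (Iso M (h.toRep hf)) := by
  have := M.finite_dart
  obtain ⟨v, hv⟩ := M.exists_vertexEquiv r'
  exact ⟨{
    vertexEquiv := v.symm.trans (Quotient.congr e fun x y => (sameCycle_equiv_iff hrot).symm)
    dartEquiv := e
    map_origin := fun x =>
      (congrArg (Quotient.congr e fun x y => (sameCycle_equiv_iff hrot).symm)
        (v.symm_apply_eq.2 (hv x).symm)).symm
    map_flip := fun x => (hflip x).symm
    map_rot := fun x => (hrot x).symm
    map_root := (congrArg some her).symm.trans (congrArg (Option.map e) hr).symm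
    map_tree := htree }⟩

theorem exists_code {r : M.Dart} (hr : M.root = some r) {n : ℕ} (hn : Nat.card M.Dart = n + 1) :
    ∃ (c : Perm (Fin (n + 1)) × Perm (Fin (n + 1)))
      (h : IsTreeCode (finRotate (n + 1)) 0 (M.numVertices - 1) M.outerDegree c.1 c.2),
      Nonempty (Iso M (h.toRep sameCycle_finRotate)) := by
  have := M.finite_dart
  have hS := M.isSpanningTree.flip_mem
  obtain ⟨e, he, hef⟩ := exists_equiv_fin
    (sameCycle_of_numCycles_eq_one (M.isSpanningTree.tour_aux r).1) r hn
  have h := (M.isTreeCode hr).transport hef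
  rw [he] at h
  have h1 := EmbeddedGraph.tour_mul_flipOn hS
  have h2 := EmbeddedGraph.flipOn_mul_flipOn_compl hS
  have h3 : ∀ x, M.flipOn M.tree hS x ≠ x ↔ x ∈ M.tree := fun x => EmbeddedGraph.flipOn_ne_iff hS
  generalize M.flipOn M.tree hS = a at h h1 h2 h3
  generalize M.flipOn M.treeᶜ (EmbeddedGraph.flip_mem_compl hS) = b at h h2
  generalize EmbeddedGraph.tour M.tree hS = f at hef h1
  refine ⟨(e.permCongr a, e.permCongr b), h,
    M.iso_toRep h sameCycle_finRotate hr he (fun x => ?_) (fun x => ?_) fun x => ?_⟩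
  · rw [← h1]
    simp [permCongr_apply, ← hef]
  · rw [← h2]
    simp [permCongr_apply]
  · rw [← h3]
    simp [permCongr_apply]

theorem isEmpty_dart_of_root (h : M.root = none) :
    IsEmpty M.Dart ∧ M.numVertices = 1 ∧ M.outerDegree = 0 := by
  have hD := M.root_eq_none h
  have := M.finite_vertex
  refine ⟨hD, ?_, by rw [RootedPlanarMap.outerDegree, h]⟩
  have hne := M.connected.nonempty
  have : Subsingleton M.Vertex := ⟨fun u v => by
    obtain ⟨p⟩ := M.connected.preconnected u v
    cases p with
    | nil => rfl
    | cons hadj _ =>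
      rw [SimpleGraph.fromRel_adj] at hadj
      rcases hadj.2 with ⟨a, _⟩ | ⟨a, _⟩ <;> exact hD.elim a⟩
  exact Nat.card_unique

theorem numVertices_pos : 0 < M.numVertices := by
  have := M.finite_vertex
  have := M.connected.nonempty
  exact Nat.card_pos

/-- This relation makes the count by edges a relabelling of the count by vertices. -/
theorem numEdges_add_outerDegree :
    M.numEdges + M.outerDegree = 3 * (M.numVertices - 1) := by
  have h1 : M.numEdges = Nat.card M.Dart / 2 := rfl
  cases hr : M.root with
  | none =>
    obtain ⟨h2, h3, h4⟩ := M.isEmpty_dart_of_root hr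
    rw [h1, h3, h4, Nat.card_of_isEmpty]
  | some r =>
    have := (M.card_dart hr).2
    omega

theorem root_eq_none_of_numVertices (h : M.numVertices = 1) : M.root = none := by
  cases hr : M.root with
  | none => rfl
  | some r =>
    have h2 := (M.card_dart hr).2
    have := M.finite_dart
    have : Nonempty M.Dart := ⟨r⟩
    have : 0 < Nat.card M.Dart := Nat.card_pos
    omega

theorem iso_of_numVertices {N : TreeRootedRep} (hM : M.numVertices = 1) (hN : N.numVertices = 1) :
    Nonempty (Iso M N) := by
  have h1 := M.root_eq_none_of_numVertices hM
  have h2 := N.root_eq_none_of_numVertices hN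
  have := M.root_eq_none h1
  have := N.root_eq_none h2
  have := M.finite_vertex
  have := N.finite_vertex
  exact ⟨{ vertexEquiv := (Finite.card_eq.1 (hM.trans hN.symm)).some
           dartEquiv := Equiv.equivOfIsEmpty _ _
           map_origin := isEmptyElim
           map_flip := isEmptyElim
           map_rot := isEmptyElim
           map_root := by rw [h1, h2]; rfl
           map_tree := isEmptyElim }⟩

/-- The atomic map. -/
def atomic : TreeRootedRep where
  Vertex := Unit
  Dart := Empty
  finite_vertex := inferInstance
  finite_dart := inferInstance
  origin := Empty.elim
  flip := 1
  rot := 1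
  flip_flip := isEmptyElim
  flip_ne := isEmptyElim
  origin_eq_iff := isEmptyElim
  connected := ⟨fun _ _ => SimpleGraph.Reachable.refl _⟩
  euler := by
    have : IsEmpty Empty := inferInstance
    simp [EmbeddedGraph.numVertices, EmbeddedGraph.numFaces, EmbeddedGraph.numEdges, this]
  root := none
  root_eq_none _ := inferInstanceAs (IsEmpty Empty)
  isNearTriangulation r := isEmptyElim r
  tree := ∅
  isSpanningTree :=
    { flip_mem := isEmptyElim
      no_loop := isEmptyElim
      no_parallel := isEmptyElim
      isTree := have : Subsingleton Unit := inferInstance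
        SimpleGraph.IsTree.of_subsingleton (V := Unit) }

theorem numVertices_atomic : atomic.numVertices = 1 :=
  Nat.card_unique (α := Unit)

end TreeRootedRep

/-! ### Finiteness and cardinalities of the classes of maps. -/

namespace TreeRootedNearTriangulation

theorem ofCode_surjective {n i d : ℕ} (hi : 1 ≤ i) (hn : n + 1 + 2 * d = 6 * i) :
    Function.Surjective (ofCode (n := n) (i := i) (d := d)) := by
  rintro ⟨T, hT, hT'⟩
  induction T using Quotient.inductionOn with | _ M
  change M.numVertices = i + 1 at hT
  change M.outerDegree = d at hT'
  cases hr : M.root with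
  | none =>
    have := (M.isEmpty_dart_of_root hr).2.1
    omega
  | some r =>
    have h1 := (M.card_dart hr).2
    rw [hT, hT', Nat.add_sub_cancel] at h1
    obtain ⟨c, h, ⟨φ⟩⟩ := M.exists_code hr (n := n) (by omega)
    subst hT'
    obtain rfl : i = M.numVertices - 1 := by omega
    exact ⟨⟨c, h⟩, Subtype.ext (Quotient.sound ⟨φ.symm⟩)⟩

theorem isEmpty_withVertices {i d : ℕ} (hd : 2 * i < d) : IsEmpty (WithVertices (i + 1) d) := by
  refine ⟨fun ⟨T, hT, hT'⟩ => ?_⟩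
  induction T using Quotient.inductionOn with | _ M
  change M.numVertices = i + 1 at hT
  change M.outerDegree = d at hT'
  cases hr : M.root with
  | none =>
    have := (M.isEmpty_dart_of_root hr).2.2
    omega
  | some r =>
    have h1 := (M.card_dart hr).1
    omega

theorem unique_withVertices_one : Nonempty (Unique (WithVertices 1 0)) := by
  refine ⟨⟨⟨⟨Quotient.mk _ TreeRootedRep.atomic, TreeRootedRep.numVertices_atomic, rfl⟩⟩, ?_⟩⟩
  rintro ⟨T, hT, hT'⟩
  induction T using Quotient.inductionOn with | _ M
  exact Subtype.ext (Quotient.sound (M.iso_of_numVertices hT TreeRootedRep.numVertices_atomic))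

theorem card_withVertices {i d : ℕ} (hi : 1 ≤ i) (hd : d ≤ 2 * i) :
    Finite (WithVertices (i + 1) d) ∧
      Nat.card (WithVertices (i + 1) d) = forestCount d (2 * i - d) * forestCount 1 i := by
  obtain ⟨n, hn⟩ : ∃ n, n + 1 + 2 * d = 6 * i := ⟨6 * i - 2 * d - 1, by omega⟩
  have h := Equiv.ofBijective _ ⟨ofCode_injective (n := n) (i := i) (d := d),
    ofCode_surjective hi hn⟩
  exact ⟨Finite.of_equiv _ h, by rw [← Nat.card_congr h, card_isTreeCode hn hd]⟩

theorem finite_withVertices (v d : ℕ) : Finite (WithVertices v d) := by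
  rcases v with _ | i
  · have : IsEmpty (WithVertices 0 d) := ⟨fun ⟨T, hT, _⟩ => by
      induction T using Quotient.inductionOn with | _ M
      exact M.numVertices_pos.ne' hT⟩
    infer_instance
  · rcases lt_or_ge (2 * i) d with h | h
    · have := isEmpty_withVertices h
      infer_instance
    · rcases Nat.eq_zero_or_pos i with rfl | hi
      · obtain rfl : d = 0 := by omega
        obtain ⟨_⟩ := unique_withVertices_one
        infer_instance
      · exact (card_withVertices hi h).1

theorem numEdges_add_outerDegree (T : TreeRootedNearTriangulation) :
    ∃ i, T.numVertices = i + 1 ∧ T.numEdges + T.outerDegree = 3 * i := by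
  induction T using Quotient.inductionOn with | _ M
  have h := M.numVertices_pos
  exact ⟨M.numVertices - 1, by change M.numVertices = _; omega, M.numEdges_add_outerDegree⟩

theorem withEdges_equiv {n d i : ℕ} (h : n + d = 3 * i) :
    Nonempty (WithEdges n d ≃ WithVertices (i + 1) d) := by
  refine ⟨Equiv.subtypeEquivRight fun T => ?_⟩
  obtain ⟨j, h1, h2⟩ := T.numEdges_add_outerDegree
  constructor <;> rintro ⟨h3, h4⟩ <;> exact ⟨by omega, h4⟩

theorem isEmpty_withEdges {n d : ℕ} (h : ¬ 3 ∣ n + d) : IsEmpty (WithEdges n d) := by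
  refine ⟨fun ⟨T, h3, h4⟩ => h ?_⟩
  obtain ⟨j, h1, h2⟩ := T.numEdges_add_outerDegree
  exact ⟨j, by rw [← h2, h3, h4]⟩

theorem finite_withEdges (n d : ℕ) : Finite (WithEdges n d) := by
  by_cases h : 3 ∣ n + d
  · obtain ⟨i, hi⟩ := h
    obtain ⟨e⟩ := withEdges_equiv hi
    have := finite_withVertices (i + 1) d
    exact Finite.of_equiv _ e.symm
  · have := isEmpty_withEdges h
    infer_instance

end TreeRootedNearTriangulation

/-! ### The closed formula and its hypergeometric recurrences. -/

namespace TreeRootedNearTriangulation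

/-- The number of tree-rooted near-triangulations with `i + 1` vertices and root-face degree `d`. -/
noncomputable def count (i d : ℕ) : ℚ := (Nat.card (WithVertices (i + 1) d) : ℚ)

theorem count_eq_zero {i d : ℕ} (h : 2 * i < d) : count i d = 0 := by
  have := isEmpty_withVertices h
  rw [count, Nat.card_of_isEmpty, Nat.cast_zero]

/-- In the product of ballot and Catalan numbers the factor `(2j + 2)!` cancels, because `m + d =
2(j + 1)`. Here `m` is the number of edges off the tree. -/
theorem count_mul_factorial (j m d : ℕ) (h : m + d = 2 * (j + 1)) :
    count (j + 1) d * ((j + 1).factorial * (j + 2).factorial * m.factorial) =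
      d * (2 * j + 1 + m).factorial := by
  have h1 := (card_withVertices (i := j + 1) (d := d) (by omega) (by omega)).2
  obtain rfl : m = 2 * (j + 1) - d := by omega
  have h2 := forestCount_mul_factorial 0 (j + 1)
  simp only [zero_add, one_mul, add_zero] at h2
  rw [count, h1]
  norm_cast
  rcases d with _ | d
  · simp only [Nat.sub_zero, show 2 * (j + 1) = 2 * j + 1 + 1 by ring, forestCount_zero_succ]
    ring
  · have h3 := forestCount_mul_factorial d (2 * (j + 1) - (d + 1))
    generalize 2 * (j + 1) - (d + 1) = m at *
    rw [show m + d + 1 = 2 * (j + 1) by omega, show 2 * m + d = 2 * j + 1 + m by omega] at h3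
    rw [← h3, ← h2]
    ring

theorem count_succ_right (i d : ℕ) :
    (d : ℚ) * (4 * i - d - 1) * count i (d + 1) = (d + 1) * (2 * i - d) * count i d := by
  rcases lt_trichotomy d (2 * i) with h | h | h
  · obtain ⟨j, rfl⟩ : ∃ j, i = j + 1 := ⟨i - 1, by omega⟩
    obtain ⟨m, hm⟩ : ∃ m, m + 1 + d = 2 * (j + 1) := ⟨2 * (j + 1) - d - 1, by omega⟩
    have h1 := count_mul_factorial j (m + 1) d hm
    have h2 := count_mul_factorial j m (d + 1) (by omega)
    have h3 : (d : ℚ) = 2 * (j + 1) - m - 1 := by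
      have : ((m + 1 + d : ℕ) : ℚ) = (2 * (j + 1) : ℕ) := by rw [hm]
      push_cast at this
      linarith
    have hne : (((j + 1).factorial * (j + 2).factorial * m.factorial : ℕ) : ℚ) ≠ 0 := by positivity
    apply mul_right_cancel₀ hne
    rw [← add_assoc, Nat.factorial_succ (2 * j + 1 + m), Nat.factorial_succ m] at h1
    push_cast at *
    generalize count (j + 1) d = x at *
    generalize count (j + 1) (d + 1) = y at *
    generalize (Nat.factorial m : ℚ) = w at *
    generalize (Nat.factorial (j + 1) : ℚ) = w1 at *
    generalize (Nat.factorial (j + 2) : ℚ) = w2 at *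
    generalize (Nat.factorial (2 * j + 1 + m) : ℚ) = w3 at *
    have h4 : (4 * ((j : ℚ) + 1) - d - 1) = 2 * j + 1 + m + 1 := by rw [h3]; ring
    have h5 : (2 * ((j : ℚ) + 1) - d) = m + 1 := by rw [h3]; ring
    rw [h4, h5]
    linear_combination ((d : ℚ) * (2 * j + 1 + m + 1)) * h2 - ((d : ℚ) + 1) * h1
  · rw [count_eq_zero (i := i) (d := d + 1) (by omega), h]
    push_cast
    ring
  · rw [count_eq_zero (i := i) (d := d + 1) (by omega), count_eq_zero h]
    ring

/-- At the boundary `d = 2i + 1` or `d = 2i + 2` the left factors vanish, so the relation holds for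
all `i` and `d`, as generating functions require. -/
theorem count_succ_left (i d : ℕ) :
    ((i : ℚ) + 1) * (i + 2) * (2 * i + 2 - d) * (2 * i + 1 - d) * count (i + 1) d =
      (4 * i - d) * (4 * i - d + 1) * (4 * i - d + 2) * (4 * i - d + 3) * count i d := by
  rcases lt_or_ge (2 * i) d with h | h
  · rw [count_eq_zero h, mul_zero]
    rcases lt_trichotomy d (2 * i + 2) with h' | h' | h'
    · obtain rfl : d = 2 * i + 1 := by omega
      push_cast
      ring
    · rw [h']
      push_cast
      ring
    · rw [count_eq_zero (by omega), mul_zero]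
  · rcases i with _ | j
    · obtain rfl : d = 0 := by omega
      have h1 := count_mul_factorial 0 2 0 rfl
      norm_num at h1
      rw [zero_add, h1]
      simp
    · obtain ⟨m, hm⟩ : ∃ m, m + d = 2 * (j + 1) := ⟨2 * (j + 1) - d, by omega⟩
      have h1 := count_mul_factorial j m d hm
      have h2 := count_mul_factorial (j + 1) (m + 2) d (by omega)
      have h3 : (d : ℚ) = 2 * (j + 1) - m := by
        have : ((m + d : ℕ) : ℚ) = (2 * (j + 1) : ℕ) := by rw [hm]
        push_cast at this
        linarith
      have hne : (((j + 1).factorial * (j + 2).factorial * m.factorial : ℕ) : ℚ) ≠ 0 := by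
        positivity
      apply mul_right_cancel₀ hne
      rw [show 2 * (j + 1) + 1 + (m + 2) = 2 * j + 1 + m + 1 + 1 + 1 + 1 by ring,
        Nat.factorial_succ (2 * j + 1 + m + 1 + 1 + 1), Nat.factorial_succ (2 * j + 1 + m + 1 + 1),
        Nat.factorial_succ (2 * j + 1 + m + 1), Nat.factorial_succ (2 * j + 1 + m),
        Nat.factorial_succ (m + 1), Nat.factorial_succ m,
        show j + 1 + 1 = j + 2 by ring, show j + 1 + 2 = j + 2 + 1 by ring,
        Nat.factorial_succ (j + 2)] at h2
      rw [show j + 2 = j + 1 + 1 by ring, Nat.factorial_succ (j + 1)] at *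
      push_cast at *
      simp only [show j + 1 + 1 = j + 2 by ring] at *
      generalize count (j + 1) d = x at *
      generalize count (j + 2) d = y at *
      generalize (Nat.factorial m : ℚ) = w at *
      generalize (Nat.factorial (j + 1) : ℚ) = w1 at *
      generalize (Nat.factorial (2 * j + 1 + m) : ℚ) = w3 at *
      have h4 : (4 * ((j : ℚ) + 1) - d) = 2 * j + 1 + m + 1 := by rw [h3]; ring
      have h5 : (2 * ((j : ℚ) + 1) + 2 - d) = m + 2 := by rw [h3]; ring
      have h6 : (2 * ((j : ℚ) + 1) + 1 - d) = m + 1 := by rw [h3]; ring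
      rw [h4, h5, h6]
      linear_combination h2 - ((2 * (j : ℚ) + 1 + m + 1) * (2 * j + 1 + m + 1 + 1) *
        (2 * j + 1 + m + 1 + 2) * (2 * j + 1 + m + 1 + 3)) * h1

theorem count_eq (i d : ℕ) (hi : 1 ≤ i) (hd : d ≤ 2 * i) :
    count i d = (d : ℚ) / (((i : ℚ) + 1) * (4 * (i : ℚ) - (d : ℚ))) *
      ((3 * i - d).choose i : ℚ) * ((4 * i - d).choose i : ℚ) := by
  obtain ⟨j, rfl⟩ : ∃ j, i = j + 1 := ⟨i - 1, by omega⟩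
  obtain ⟨m, hm⟩ : ∃ m, m + d = 2 * (j + 1) := ⟨2 * (j + 1) - d, by omega⟩
  have h1 := count_mul_factorial j m d hm
  have h2 := Nat.choose_mul_factorial_mul_factorial (n := j + 1 + m) (k := j + 1) (by omega)
  have h3 := Nat.choose_mul_factorial_mul_factorial (n := 2 * j + 1 + m + 1) (k := j + 1) (by omega)
  rw [Nat.add_sub_cancel_left] at h2
  rw [show 2 * j + 1 + m + 1 - (j + 1) = j + 1 + m by omega, Nat.factorial_succ (2 * j + 1 + m)] at h3
  rw [show 3 * (j + 1) - d = j + 1 + m by omega, show 4 * (j + 1) - d = 2 * j + 1 + m + 1 by omega]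
  have h4 : (4 * ((j + 1 : ℕ) : ℚ) - d) = 2 * j + 1 + m + 1 := by
    have : ((m + d : ℕ) : ℚ) = (2 * (j + 1) : ℕ) := by rw [hm]
    push_cast at *
    linarith
  rw [h4]
  have hne : (((j + 1).factorial * (j + 2).factorial * m.factorial : ℕ) : ℚ) ≠ 0 := by positivity
  have hne' : (((j + 1 + m).factorial : ℕ) : ℚ) ≠ 0 := by positivity
  have h2' : ((j + 1 + m).choose (j + 1) : ℚ) * (j + 1).factorial * m.factorial =
      (j + 1 + m).factorial := by exact_mod_cast h2
  have h3' : ((2 * j + 1 + m + 1).choose (j + 1) : ℚ) * (j + 1).factorial * (j + 1 + m).factorial =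
      (2 * j + 1 + m + 1) * (2 * j + 1 + m).factorial := by exact_mod_cast h3
  have h5 : (0 : ℚ) < 2 * j + 1 + m + 1 := by positivity
  have h6 : (0 : ℚ) < ((j + 1 : ℕ) : ℚ) + 1 := by positivity
  rw [div_mul_eq_mul_div, div_mul_eq_mul_div, eq_div_iff (by positivity)]
  apply mul_right_cancel₀ hne
  apply mul_right_cancel₀ hne'
  have h7 : ((j + 2).factorial : ℚ) = (((j + 1 : ℕ) : ℚ) + 1) * (j + 1).factorial := by
    rw [Nat.factorial_succ (j + 1)]
    push_cast
    ring
  push_cast at *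
  rw [h7] at h1 ⊢
  generalize count (j + 1) d = x at *
  generalize ((j + 1 + m).choose (j + 1) : ℚ) = y1 at *
  generalize ((2 * j + 1 + m + 1).choose (j + 1) : ℚ) = y2 at *
  generalize (Nat.factorial m : ℚ) = w at *
  generalize (Nat.factorial (j + 1) : ℚ) = w1 at *
  generalize (Nat.factorial (j + 1 + m) : ℚ) = w2 at *
  generalize (Nat.factorial (2 * j + 1 + m) : ℚ) = w3 at *
  linear_combination (((j : ℚ) + 1 + 1) * (2 * j + 1 + m + 1) * w2) * h1 -
    (d * ((j : ℚ) + 1 + 1) * w2 * y2 * w1) * h2' - (d * ((j : ℚ) + 1 + 1) * w2) * h3'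

end TreeRootedNearTriangulation

/-! ### Elimination on leading forms of polynomial weights. -/

namespace PolynomialWeight

variable {C : Type*} [CommRing C] [Algebra ℚ C] (I D : C)

/-- The span of `1`, `I` and `D`. Its powers filter the algebra that `I` and `D` generate. -/
def affineSpan : Submodule ℚ C := Submodule.span ℚ {1, I, D}

/-- The elements of filtration degree less than `n`. -/
def lower : ℕ → Submodule ℚ C
  | 0 => ⊥
  | n + 1 => affineSpan I D ^ n

/-- `f` has degree at most `n`, with the same leading part as `g`. -/
def SameLeading (n : ℕ) (f g : C) : Prop := g ∈ affineSpan I D ^ n ∧ f - g ∈ lower I D n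

variable {I D}

theorem one_mem_affineSpan : (1 : C) ∈ affineSpan I D := Submodule.subset_span (by simp)

theorem left_mem_affineSpan : I ∈ affineSpan I D := Submodule.subset_span (by simp)

theorem right_mem_affineSpan : D ∈ affineSpan I D := Submodule.subset_span (by simp)

theorem algebraMap_mem_affineSpan (c : ℚ) : algebraMap ℚ C c ∈ affineSpan I D := by
  rw [Algebra.algebraMap_eq_smul_one]
  exact Submodule.smul_mem _ _ one_mem_affineSpan

theorem monomial_mem (a b : ℕ) : I ^ a * D ^ b ∈ affineSpan I D ^ (a + b) := by
  rw [pow_add]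
  exact Submodule.mul_mem_mul (Submodule.pow_mem_pow _ left_mem_affineSpan a)
    (Submodule.pow_mem_pow _ right_mem_affineSpan b)

theorem affineSpan_pow_mono : Monotone fun n => affineSpan I D ^ n := by
  refine monotone_nat_of_le_succ fun n x hx => ?_
  rw [pow_succ, ← mul_one x]
  exact Submodule.mul_mem_mul hx one_mem_affineSpan

theorem lower_le (n : ℕ) : lower I D n ≤ affineSpan I D ^ n := by
  cases n with
  | zero => exact bot_le
  | succ n => exact affineSpan_pow_mono n.le_succ

theorem mul_mem_lower {m n : ℕ} {f g : C} (hf : f ∈ lower I D m) (hg : g ∈ affineSpan I D ^ n) :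
    f * g ∈ lower I D (m + n) := by
  cases m with
  | zero =>
    rw [(Submodule.mem_bot ℚ).1 hf, zero_mul]
    exact zero_mem _
  | succ m =>
    rw [Nat.succ_add]
    change f * g ∈ affineSpan I D ^ (m + n)
    rw [pow_add]
    exact Submodule.mul_mem_mul hf hg

namespace SameLeading

theorem of_mem {n : ℕ} {f : C} (hf : f ∈ affineSpan I D ^ n) : SameLeading I D n f f :=
  ⟨hf, by rw [sub_self]; exact zero_mem _⟩

theorem left_mem {n : ℕ} {f g : C} (h : SameLeading I D n f g) : f ∈ affineSpan I D ^ n := by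
  have := add_mem (lower_le n h.2) h.1
  rwa [sub_add_cancel] at this

theorem mul {m n : ℕ} {f g f' g' : C} (h : SameLeading I D m f g) (h' : SameLeading I D n f' g') :
    SameLeading I D (m + n) (f * f') (g * g') := by
  refine ⟨?_, ?_⟩
  · rw [pow_add]
    exact Submodule.mul_mem_mul h.1 h'.1
  · have h1 := mul_mem_lower h.2 h'.left_mem
    have h2 := mul_mem_lower h'.2 h.1
    rw [add_comm n m] at h2
    convert add_mem h1 h2 using 1
    ring

theorem pow {f g : C} (h : SameLeading I D 1 f g) (n : ℕ) :
    SameLeading I D n (f ^ n) (g ^ n) := by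
  induction n with
  | zero =>
    rw [pow_zero, pow_zero]
    exact of_mem (by rw [pow_zero]; exact Submodule.one_le.1 le_rfl)
  | succ n ih =>
    rw [pow_succ, pow_succ]
    exact ih.mul h

theorem of_sub {f g : C} (c : ℚ) (hg : g ∈ affineSpan I D) (h : f = g + algebraMap ℚ C c) :
    SameLeading I D 1 f g := by
  refine ⟨by rwa [pow_one], ?_⟩
  change f - g ∈ affineSpan I D ^ 0
  rw [h, add_sub_cancel_left, pow_zero, Submodule.mem_one]
  exact ⟨c, rfl⟩

end SameLeading

theorem affineSpan_pow_le (n : ℕ) :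
    affineSpan I D ^ n ≤ Submodule.span ℚ {f | ∃ a b, a + b ≤ n ∧ f = I ^ a * D ^ b} := by
  induction n with
  | zero =>
    rw [pow_zero, Submodule.one_le]
    exact Submodule.subset_span ⟨0, 0, le_rfl, by simp⟩
  | succ n ih =>
    rw [pow_succ]
    refine (mul_le_mul_left ih _).trans ?_
    rw [affineSpan, Submodule.span_mul_span, Submodule.span_le]
    rintro _ ⟨_, ⟨a, b, h, rfl⟩, g, hg, rfl⟩
    apply Submodule.subset_span
    rcases hg with rfl | rfl | rfl
    · exact ⟨a, b, by omega, by simp⟩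
    · exact ⟨a + 1, b, by omega, by simp only; ring⟩
    · exact ⟨a, b + 1, by omega, by simp only; ring⟩

variable {R Q : Type*} [CommRing R] [IsDomain R] [AddCommGroup Q] [Module R Q]
  [Module.IsTorsionFree R Q]

/-- Here `w a` stands for the class of `I^a * D^(n + 5 - a)`. The leading form of the first
recurrence vanishes at `(I : D) = (q : p)` apart from its root `D = 0`. The expression in `hΔ` is
the second leading form, `I²(2I - D)² - z(4I - D)⁴`, at that point, and `4 - 256z` is its value at
`(1 : 0)`. The three conditions exclude common zeros. -/
theorem eq_zero_of_recurrence (w : ℕ → Q) (n : ℕ) (p q z : R) (hp : p ≠ 0)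
    (hz : 4 - 256 * z ≠ 0)
    (hΔ : 4 * q ^ 4 - 4 * q ^ 3 * p + q ^ 2 * p ^ 2 -
      z * (256 * q ^ 4 - 256 * q ^ 3 * p + 96 * q ^ 2 * p ^ 2 - 16 * q * p ^ 3 + p ^ 4) ≠ 0)
    (h1 : ∀ a ≤ n + 3, p • w (a + 1) = q • w a)
    (h2 : ∀ a ≤ n + 1, 4 • w (a + 4) - 4 • w (a + 3) + w (a + 2) =
      z • (256 • w (a + 4) - 256 • w (a + 3) + 96 • w (a + 2) - 16 • w (a + 1) + w a)) :
    ∀ a ≤ n + 5, w a = 0 := by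
  have hlt : ∀ a ≤ n + 4, w a = 0 := by
    intro a
    induction a with
    | zero =>
      intro _
      have h := h2 0 (by omega)
      rw [zero_add, zero_add, zero_add, zero_add] at h
      have k1 := h1 0 (by omega)
      have k2 : p ^ 2 • w 2 = q ^ 2 • w 0 := by
        linear_combination (norm := module) p • h1 1 (by omega) + q • k1
      have k3 : p ^ 3 • w 3 = q ^ 3 • w 0 := by
        linear_combination (norm := module) p ^ 2 • h1 2 (by omega) + q • k2
      have k4 : p ^ 4 • w 4 = q ^ 4 • w 0 := by
        linear_combination (norm := module) p ^ 3 • h1 3 (by omega) + q • k3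
      refine (smul_eq_zero.1 ?_).resolve_left hΔ
      linear_combination (norm := module) p ^ 4 • h - (4 - 256 * z) • k4 +
        ((4 - 256 * z) * p) • k3 - ((1 - 96 * z) * p ^ 2) • k2 - (16 * z * p ^ 3) • k1
    | succ a ih =>
      intro ha
      have h := h1 a (by omega)
      rw [ih (by omega), smul_zero] at h
      exact (smul_eq_zero.1 h).resolve_left hp
  intro a ha
  -- The first recurrence stops at `w (n + 4)` since its leading form is divisible by `D`; the pure
  -- power of `I` needs the second one.
  rcases Nat.lt_or_eq_of_le ha with h | rfl
  · exact hlt a (by omega)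
  · have h := h2 (n + 1) le_rfl
    rw [hlt (n + 1) (by omega), hlt (n + 1 + 1) (by omega), hlt (n + 1 + 2) (by omega),
      hlt (n + 1 + 3) (by omega)] at h
    refine (smul_eq_zero.1 ?_).resolve_left hz
    linear_combination (norm := module) h

variable [Module ℚ Q]

theorem map_eq_of_sameLeading (e : C →ₗ[ℚ] Q) {n : ℕ} (he : ∀ f ∈ lower I D n, e f = 0) {f g : C}
    (h : SameLeading I D n f g) : e f = e g := by
  rw [← sub_eq_zero, ← map_sub]
  exact he _ h.2

/-- Induction on the degree: when `e` kills lower degrees, the shifts by constants in `h1` and `h2`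
disappear and relations among monomials of top degree remain. Degree 5 is the first in which the
first recurrence links all of `w 0, ..., w 4`, hence the bound 4. -/
theorem map_eq_zero_of_recurrence (e : C →ₗ[ℚ] Q) (u v z : R)
    (hp : 4 * u - 2 * v ≠ 0) (hz : 4 - 256 * z ≠ 0)
    (hΔ : 4 * (u - v) ^ 4 - 4 * (u - v) ^ 3 * (4 * u - 2 * v) +
      (u - v) ^ 2 * (4 * u - 2 * v) ^ 2 - z * (256 * (u - v) ^ 4 -
        256 * (u - v) ^ 3 * (4 * u - 2 * v) + 96 * (u - v) ^ 2 * (4 * u - 2 * v) ^ 2 -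
        16 * (u - v) * (4 * u - 2 * v) ^ 3 + (4 * u - 2 * v) ^ 4) ≠ 0)
    (h1 : ∀ a b, u • e (I ^ a * D ^ b * ((D - 1) * (4 * I - D))) =
      v • e (I ^ a * (D + 1) ^ b * ((D + 1) * (2 * I - D))))
    (h2 : ∀ a b, e (I ^ a * D ^ b * (I * (I + 1) * ((2 * I - D) * (2 * I - D - 1)))) =
      z • e ((I + 1) ^ a * D ^ b *
        ((4 * I - D) * (4 * I - D + 1) * ((4 * I - D + 2) * (4 * I - D + 3)))))
    (h4 : ∀ f ∈ affineSpan I D ^ 4, e f = 0) (n : ℕ) : ∀ f ∈ affineSpan I D ^ n, e f = 0 := by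
  have hI : I ∈ affineSpan I D := left_mem_affineSpan
  have hD : D ∈ affineSpan I D := right_mem_affineSpan
  have h2I : 2 * I - D ∈ affineSpan I D := by
    have := sub_mem (Submodule.smul_mem _ (2 : ℚ) hI) hD
    rwa [Algebra.smul_def, map_ofNat] at this
  have h4I : 4 * I - D ∈ affineSpan I D := by
    have := sub_mem (Submodule.smul_mem _ (4 : ℚ) hI) hD
    rwa [Algebra.smul_def, map_ofNat] at this
  have refl : ∀ {f : C}, f ∈ affineSpan I D → SameLeading I D 1 f f :=
    fun h => .of_mem (by rwa [pow_one])
  have step : ∀ n, (∀ f ∈ affineSpan I D ^ (n + 4), e f = 0) →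
      ∀ f ∈ affineSpan I D ^ (n + 5), e f = 0 := by
    intro n ih
    have key : ∀ {m : ℕ} {f g : C}, m = n + 5 → SameLeading I D m f g → e f = e g := by
      rintro _ f g rfl h
      exact map_eq_of_sameLeading (n := n + 5) (I := I) (D := D) e ih h
    have hw := eq_zero_of_recurrence (fun a => e (I ^ a * D ^ (n + 5 - a))) n (4 * u - 2 * v)
      (u - v) z hp hz hΔ ?_ ?_
    · intro f hf
      rw [← LinearMap.mem_ker]
      refine Submodule.span_le.2 ?_ (affineSpan_pow_le _ hf)
      rintro _ ⟨a, b, hab, rfl⟩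
      rw [SetLike.mem_coe, LinearMap.mem_ker]
      rcases Nat.lt_or_eq_of_le hab with h | h
      · exact ih _ (affineSpan_pow_mono (show a + b ≤ n + 4 by omega) (monomial_mem a b))
      · obtain rfl : b = n + 5 - a := by omega
        exact hw a (by omega)
    · intro a ha
      obtain ⟨b, hb⟩ : ∃ b, b + a = n + 3 := ⟨n + 3 - a, by omega⟩
      have h := h1 a b
      rw [key (by omega) (((SameLeading.of_mem (I := I) (D := D) (monomial_mem a b)).mul
          ((SameLeading.of_sub (-1) hD (by simp [sub_eq_add_neg])).mul (refl h4I)))),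
        key (by omega) (((refl hI).pow a).mul ((SameLeading.of_sub 1 hD (by simp)).pow b) |>.mul
          ((SameLeading.of_sub 1 hD (by simp)).mul (refl h2I))),
        show I ^ a * D ^ b * (D * (4 * I - D)) =
          4 • (I ^ (a + 1) * D ^ (b + 1)) - I ^ a * D ^ (b + 2) by
            simp only [nsmul_eq_mul]; push_cast; ring,
        show I ^ a * D ^ b * (D * (2 * I - D)) =
          2 • (I ^ (a + 1) * D ^ (b + 1)) - I ^ a * D ^ (b + 2) by
            simp only [nsmul_eq_mul]; push_cast; ring,
        map_sub, map_sub, map_nsmul, map_nsmul] at h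
      rw [show n + 5 - a = b + 2 by omega, show n + 5 - (a + 1) = b + 1 by omega]
      linear_combination (norm := module) h
    · intro a ha
      obtain ⟨b, hb⟩ : ∃ b, b + a = n + 1 := ⟨n + 1 - a, by omega⟩
      have h := h2 a b
      rw [key (by omega) (((SameLeading.of_mem (I := I) (D := D) (monomial_mem a b)).mul
          (((refl hI).mul (SameLeading.of_sub 1 hI (by simp))).mul
            ((refl h2I).mul (SameLeading.of_sub (-1) h2I (by simp [sub_eq_add_neg])))))),
        key (by omega) ((((SameLeading.of_sub 1 hI (by simp)).pow a).mul ((refl hD).pow b)).mul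
          (((refl h4I).mul (SameLeading.of_sub 1 h4I (by simp))).mul
            ((SameLeading.of_sub 2 h4I (by rw [map_ofNat])).mul (SameLeading.of_sub 3 h4I (by rw [map_ofNat]))))),
        show I ^ a * D ^ b * (I * I * ((2 * I - D) * (2 * I - D))) =
          4 • (I ^ (a + 4) * D ^ b) - 4 • (I ^ (a + 3) * D ^ (b + 1)) +
            I ^ (a + 2) * D ^ (b + 2) by
            simp only [nsmul_eq_mul]; push_cast; ring,
        show I ^ a * D ^ b * ((4 * I - D) * (4 * I - D) * ((4 * I - D) * (4 * I - D))) =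
          256 • (I ^ (a + 4) * D ^ b) - 256 • (I ^ (a + 3) * D ^ (b + 1)) +
            96 • (I ^ (a + 2) * D ^ (b + 2)) - 16 • (I ^ (a + 1) * D ^ (b + 3)) +
            I ^ a * D ^ (b + 4) by
            simp only [nsmul_eq_mul]; push_cast; ring] at h
      simp only [map_add, map_sub, map_nsmul] at h
      rw [show n + 5 - a = b + 4 by omega, show n + 5 - (a + 1) = b + 3 by omega,
        show n + 5 - (a + 2) = b + 2 by omega, show n + 5 - (a + 3) = b + 1 by omega,
        show n + 5 - (a + 4) = b by omega]
      exact h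
  have all : ∀ n, ∀ f ∈ affineSpan I D ^ (n + 4), e f = 0 := fun n => by
    induction n with
    | zero => simpa using h4
    | succ n ih => exact step n ih
  exact fun f hf => all n f (affineSpan_pow_mono (by omega) hf)

end PolynomialWeight

/-! ### A criterion for D-finiteness. -/

namespace PolynomialWeight

open MvPowerSeries

variable {σ : Type*}

/-- Multiply the coefficients of a power series by a function of the exponent. -/
def weight (F : MvPowerSeries σ ℚ) : ((σ →₀ ℕ) → ℚ) →ₗ[ℚ] MvPowerSeries σ ℚ where
  toFun p := fun m => p m * F m
  map_add' p q := by ext m; exact add_mul _ _ _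
  map_smul' c p := by ext m; exact mul_assoc _ _ _

theorem coeff_weight (F : MvPowerSeries σ ℚ) (p : (σ →₀ ℕ) → ℚ) (m : σ →₀ ℕ) :
    coeff m (weight F p) = p m * coeff m F := rfl

theorem weight_one (F : MvPowerSeries σ ℚ) : weight F 1 = F := by
  ext m
  rw [coeff_weight, Pi.one_apply, one_mul]

theorem X_mul_pderiv_weight (F : MvPowerSeries σ ℚ) (k : σ) (p : (σ →₀ ℕ) → ℚ) :
    X k * pderiv ℚ k (weight F p) = weight F ((fun m => (m k : ℚ)) * p) := by
  classical
  ext m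
  rw [X_def, coeff_monomial_mul, one_mul, coeff_weight, Pi.mul_apply]
  split_ifs with h
  · have h1 : m - Finsupp.single k 1 + Finsupp.single k 1 = m := tsub_add_cancel_of_le h
    have h2 : (m - Finsupp.single k 1 : σ →₀ ℕ) k + 1 = m k := by
      conv_rhs => rw [← h1]
      simp
    rw [coeff_pderiv, h1, coeff_weight, ← h2]
    push_cast
    ring
  · have h0 : m k = 0 := by
      by_contra h0
      exact h (Finsupp.single_le_iff.2 (Nat.one_le_iff_ne_zero.2 h0))
    rw [h0, Nat.cast_zero, zero_mul, zero_mul]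

/-- The identity `x^j ∂^j = θ(θ - 1)...(θ - j + 1)` for the Euler operator `θ = x ∂`, which
multiplies coefficients by the exponent. -/
theorem X_pow_mul_pderiv_iterate (F : MvPowerSeries σ ℚ) (k : σ) (j : ℕ) :
    X k ^ j * (pderiv ℚ k)^[j] F =
      weight F (∏ s ∈ Finset.range j, ((fun m => (m k : ℚ)) - algebraMap ℚ _ (s : ℚ))) := by
  induction j with
  | zero => simp [weight_one]
  | succ j ih =>
    have hj : X k * pderiv ℚ k (X k ^ j) = (j : MvPowerSeries σ ℚ) * X k ^ j := by
      rw [Derivation.leibniz_pow, pderiv_X_self]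
      cases j with
      | zero => simp
      | succ j =>
        rw [Nat.add_sub_cancel, nsmul_eq_mul, smul_eq_mul, mul_one, pow_succ']
        ring
    have h : X k * pderiv ℚ k (X k ^ j * (pderiv ℚ k)^[j] F) = _ :=
      (congrArg (fun G => X k * pderiv ℚ k G) ih).trans (X_mul_pderiv_weight F k _)
    rw [Derivation.leibniz, smul_eq_mul, smul_eq_mul] at h
    rw [Finset.prod_range_succ, mul_comm (Finset.prod _ _), sub_mul, map_sub, ← h,
      Function.iterate_succ_apply', ← Algebra.smul_def, map_smul, ← ih,
      show ((j : ℚ) • (X k ^ j * (pderiv ℚ k)^[j] F)) =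
        (j : MvPowerSeries σ ℚ) * (X k ^ j * (pderiv ℚ k)^[j] F) by
          rw [Nat.cast_smul_eq_nsmul, nsmul_eq_mul]]
    linear_combination -(pderiv ℚ k)^[j] F * hj

theorem prod_mem_affineSpan_pow {C : Type*} [CommRing C] [Algebra ℚ C] {I D f : C}
    (hf : f ∈ affineSpan I D) (j : ℕ) :
    ∏ s ∈ Finset.range j, (f - algebraMap ℚ C (s : ℚ)) ∈ affineSpan I D ^ j := by
  induction j with
  | zero => exact Submodule.one_le.1 le_rfl
  | succ j ih =>
    rw [Finset.prod_range_succ, pow_succ]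
    exact Submodule.mul_mem_mul ih (sub_mem hf (algebraMap_mem_affineSpan _))

/-- One more derivative than there are generators of `M` forces a linear relation over the
polynomial ring; the factors `q` are absorbed into its coefficients. -/
theorem isDFinite_of_smul_mem {K : Type*} [Field K] (F : MvPowerSeries σ K)
    (M : Submodule (MvPolynomial σ K) (MvPowerSeries σ K)) (hM : M.FG)
    (h : ∀ k j, ∃ q : MvPolynomial σ K, q ≠ 0 ∧ q • (pderiv K k)^[j] F ∈ M) : IsDFinite F := by
  obtain ⟨S, rfl⟩ := hM
  intro k
  choose q hq hqM using h k
  have hdep : ¬ LinearIndependent (MvPolynomial σ K)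
      (fun j : Fin (S.card + 1) => q j • (pderiv K k)^[(j : ℕ)] F) := by
    intro hli
    have := linearIndependent_le_span' _ hli (S : Set (MvPowerSeries σ K)) (by
      rintro _ ⟨j, rfl⟩
      exact hqM j)
    simp at this
  obtain ⟨g, hg, j, hj⟩ := Fintype.not_linearIndependent_iff.1 hdep
  refine ⟨S.card, fun j => g j * q j, ⟨j, mul_ne_zero hj (hq j)⟩, ?_⟩
  rw [← hg]
  refine Finset.sum_congr rfl fun j _ => ?_
  rw [smul_smul]
  rfl

theorem isDFinite_of_recurrence [Finite σ] (F : MvPowerSeries σ ℚ) (I D : (σ →₀ ℕ) → ℚ)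
    (hX : ∀ k, (fun m => (m k : ℚ)) ∈ affineSpan I D) (u v z : MvPolynomial σ ℚ)
    (hp : 4 * u - 2 * v ≠ 0) (hz : 4 - 256 * z ≠ 0)
    (hΔ : 4 * (u - v) ^ 4 - 4 * (u - v) ^ 3 * (4 * u - 2 * v) +
      (u - v) ^ 2 * (4 * u - 2 * v) ^ 2 - z * (256 * (u - v) ^ 4 -
        256 * (u - v) ^ 3 * (4 * u - 2 * v) + 96 * (u - v) ^ 2 * (4 * u - 2 * v) ^ 2 -
        16 * (u - v) * (4 * u - 2 * v) ^ 3 + (4 * u - 2 * v) ^ 4) ≠ 0)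
    (h1 : ∀ a b, u • weight F (I ^ a * D ^ b * ((D - 1) * (4 * I - D))) =
      v • weight F (I ^ a * (D + 1) ^ b * ((D + 1) * (2 * I - D))))
    (h2 : ∀ a b, weight F (I ^ a * D ^ b * (I * (I + 1) * ((2 * I - D) * (2 * I - D - 1)))) =
      z • weight F ((I + 1) ^ a * D ^ b *
        ((4 * I - D) * (4 * I - D + 1) * ((4 * I - D + 2) * (4 * I - D + 3))))) :
    IsDFinite F := by
  have hfg : (affineSpan I D ^ 4).FG :=
    Submodule.FG.pow (Submodule.fg_span (Set.toFinite _)) 4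
  obtain ⟨S, hS⟩ := hfg
  set M := Submodule.span (MvPolynomial σ ℚ) (weight F '' (S : Set _)) with hM
  refine isDFinite_of_smul_mem F M (Submodule.fg_span (S.finite_toSet.image _)) fun k j => ?_
  -- Passing to the torsion-free quotient permits cancelling the nonzero polynomials of `hp`, `hz`
  -- and `hΔ`. The price is the multiplier `c` extracted below.
  let T := Submodule.torsion (MvPolynomial σ ℚ) (MvPowerSeries σ ℚ ⧸ M)
  let e : ((σ →₀ ℕ) → ℚ) →ₗ[ℚ] ((MvPowerSeries σ ℚ ⧸ M) ⧸ T) :=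
    ((T.mkQ ∘ₗ M.mkQ).restrictScalars ℚ) ∘ₗ weight F
  have he : ∀ p, e p = T.mkQ (M.mkQ (weight F p)) := fun _ => rfl
  have h4 : ∀ p ∈ affineSpan I D ^ 4, e p = 0 := by
    rw [← hS]
    intro p hp
    rw [← LinearMap.mem_ker]
    refine Submodule.span_le.2 ?_ hp
    intro s hs
    have hs' : M.mkQ (weight F s) = 0 :=
      (Submodule.Quotient.mk_eq_zero M).2 (Submodule.subset_span ⟨s, hs, rfl⟩)
    rw [SetLike.mem_coe, LinearMap.mem_ker, he, hs', map_zero]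
  have h := map_eq_zero_of_recurrence e u v z hp hz hΔ
    (fun a b => by simp only [he, ← map_smul, h1]) (fun a b => by rw [he, h2, map_smul, map_smul, he])
    h4 j _ (prod_mem_affineSpan_pow (hX k) j)
  rw [he, ← X_pow_mul_pderiv_iterate, Submodule.mkQ_apply, Submodule.Quotient.mk_eq_zero,
    Submodule.mem_torsion_iff] at h
  obtain ⟨⟨c, hc⟩, h⟩ := h
  refine ⟨c * MvPolynomial.X k ^ j, mul_ne_zero (nonZeroDivisors.ne_zero hc)
    (pow_ne_zero _ (MvPolynomial.X_ne_zero k)), ?_⟩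
  have hsmul : (MvPolynomial.X k : MvPolynomial σ ℚ) ^ j • (pderiv ℚ k)^[j] F =
      X k ^ j * (pderiv ℚ k)^[j] F := by
    change ((MvPolynomial.X k ^ j : MvPolynomial σ ℚ) : MvPowerSeries σ ℚ) * _ = _
    rw [MvPolynomial.coe_pow, MvPolynomial.coe_X]
  rw [mul_smul, hsmul, ← Submodule.Quotient.mk_eq_zero M]
  exact h

end PolynomialWeight

/-! ### D-finiteness of the two generating functions. -/

namespace TreeRootedNearTriangulation

open MvPowerSeries PolynomialWeight

theorem coeff_X_pow_smul (k : Fin 2) (n : ℕ) (G : MvPowerSeries (Fin 2) ℚ) (m : Fin 2 →₀ ℕ) :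
    coeff m ((MvPolynomial.X k : MvPolynomial (Fin 2) ℚ) ^ n • G) =
      if n ≤ m k then coeff (m - Finsupp.single k n) G else 0 := by
  classical
  change coeff m (((MvPolynomial.X k ^ n : MvPolynomial (Fin 2) ℚ) : MvPowerSeries (Fin 2) ℚ) * G) = _
  rw [MvPolynomial.coe_pow, MvPolynomial.coe_X, X_pow_eq, coeff_monomial_mul, one_mul]
  simp only [Finsupp.single_le_iff]

theorem coeff_X_smul (k : Fin 2) (G : MvPowerSeries (Fin 2) ℚ) (m : Fin 2 →₀ ℕ) :
    coeff m ((MvPolynomial.X k : MvPolynomial (Fin 2) ℚ) • G) =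
      if 1 ≤ m k then coeff (m - Finsupp.single k 1) G else 0 := by
  rw [← coeff_X_pow_smul, pow_one]

theorem coeff_vertexSeries (m : Fin 2 →₀ ℕ) : coeff m vertexSeries = count (m 0) (m 1) := rfl

theorem mul_count_zero_right (i : ℕ) : (i : ℚ) * count i 0 = 0 := by
  have h := count_succ_right i 0
  simp only [Nat.cast_zero, zero_mul, zero_add, one_mul, sub_zero] at h
  linear_combination -h / 2

theorem isDFinite_vertexSeries : IsDFinite vertexSeries := by
  refine isDFinite_of_recurrence vertexSeries (fun m => (m 0 : ℚ)) (fun m => (m 1 : ℚ)) ?_ 1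
    (MvPolynomial.X 1) (MvPolynomial.X 0) ?_ ?_ ?_ ?_ ?_
  · intro k
    fin_cases k
    · exact left_mem_affineSpan
    · exact right_mem_affineSpan
  · intro h
    have := congrArg (MvPolynomial.eval ![0, 0]) h
    norm_num at this
  · intro h
    have := congrArg (MvPolynomial.eval ![0, 0]) h
    norm_num at this
  · intro h
    have := congrArg (MvPolynomial.eval ![0, 0]) h
    norm_num at this
  · intro a b
    ext m
    rw [one_smul, coeff_X_smul, coeff_weight, coeff_weight, coeff_vertexSeries, coeff_vertexSeries]
    obtain ⟨i, hi⟩ : ∃ i, m 0 = i := ⟨_, rfl⟩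
    rcases hd : m 1 with _ | d
    -- Multiplication by `y` leaves no coefficient at `y^0`, so the other side must vanish there:
    -- only the atomic map has root-face degree `0`.
    · have h := mul_count_zero_right i
      simp only [Pi.mul_apply, Pi.pow_apply, Pi.sub_apply, Pi.ofNat_apply, hi, hd,
        CharP.cast_eq_zero]
      rw [if_neg (by norm_num)]
      linear_combination -(i : ℚ) ^ a * 0 ^ b * 4 * h
    · have h := count_succ_right i d
      simp [hi, hd]
      linear_combination (i : ℚ) ^ a * (d + 1) ^ b * h
  · intro a b
    ext m
    rw [coeff_X_smul, coeff_weight, coeff_weight, coeff_vertexSeries, coeff_vertexSeries]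
    obtain ⟨d, hd⟩ : ∃ d, m 1 = d := ⟨_, rfl⟩
    rcases hi : m 0 with _ | i
    · simp [hi, hd]
    · have h := count_succ_left i d
      simp [hi, hd]
      linear_combination ((i : ℚ) + 1) ^ a * d ^ b * h

/-- The number of tree-rooted near-triangulations with `n` edges and root-face degree `d`. -/
noncomputable def edgeCount (n d : ℕ) : ℚ := (Nat.card (WithEdges n d) : ℚ)

theorem coeff_edgeSeries (m : Fin 2 →₀ ℕ) : coeff m edgeSeries = edgeCount (m 0) (m 1) := rfl

theorem edgeCount_eq_count {n d i : ℕ} (h : n + d = 3 * i) : edgeCount n d = count i d := by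
  obtain ⟨e⟩ := withEdges_equiv h
  exact congrArg Nat.cast (Nat.card_congr e)

theorem edgeCount_eq_zero {n d : ℕ} (h : ¬ 3 ∣ n + d) : edgeCount n d = 0 := by
  have := isEmpty_withEdges h
  rw [edgeCount, Nat.card_of_isEmpty, Nat.cast_zero]

theorem cast_add_cast_of_eq {n d i : ℕ} (h : n + d = 3 * i) : (n : ℚ) + d = 3 * i := by
  exact_mod_cast h

theorem edgeCount_succ_right (n d : ℕ) :
    (d : ℚ) * (4 * ((n + (d + 1)) / 3) - (d + 1)) * edgeCount n (d + 1) =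
      (d + 1) * (2 * ((n + 1 + d) / 3) - d) * edgeCount (n + 1) d := by
  by_cases h3 : 3 ∣ n + (d + 1)
  · obtain ⟨i, hi⟩ := h3
    have h := cast_add_cast_of_eq hi
    push_cast at h
    rw [edgeCount_eq_count hi, edgeCount_eq_count (show n + 1 + d = 3 * i by omega), add_right_comm,
      add_assoc (n : ℚ), h]
    linear_combination count_succ_right i d
  · rw [edgeCount_eq_zero h3, edgeCount_eq_zero (show ¬ 3 ∣ n + 1 + d by omega), mul_zero, mul_zero]

theorem mul_edgeCount_zero_right (n : ℕ) : (n : ℚ) * edgeCount n 0 = 0 := by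
  by_cases h3 : 3 ∣ n + 0
  · obtain ⟨i, hi⟩ := h3
    have h := cast_add_cast_of_eq hi
    rw [edgeCount_eq_count hi]
    push_cast at h
    linear_combination 3 * mul_count_zero_right i + count i 0 * h
  · rw [edgeCount_eq_zero h3, mul_zero]

theorem mul_edgeCount_zero_left (d : ℕ) : (d : ℚ) * edgeCount 0 d = 0 := by
  by_cases h3 : 3 ∣ 0 + d
  · obtain ⟨i, hi⟩ := h3
    rcases d.eq_zero_or_pos with rfl | hd
    · simp
    · rw [edgeCount_eq_count hi, count_eq_zero (by omega), mul_zero]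
  · rw [edgeCount_eq_zero h3, mul_zero]

theorem edgeCount_add_three (n d : ℕ) :
    ((n + 3 + d) / 3 : ℚ) * ((n + 3 + d) / 3 + 1) *
        ((2 * ((n + 3 + d) / 3) - d) * (2 * ((n + 3 + d) / 3) - d - 1)) * edgeCount (n + 3) d =
      (4 * ((n + d) / 3) - d) * (4 * ((n + d) / 3) - d + 1) *
        ((4 * ((n + d) / 3) - d + 2) * (4 * ((n + d) / 3) - d + 3)) * edgeCount n d := by
  by_cases h3 : 3 ∣ n + d
  · obtain ⟨i, hi⟩ := h3
    have h := cast_add_cast_of_eq hi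
    rw [edgeCount_eq_count hi, edgeCount_eq_count (show n + 3 + d = 3 * (i + 1) by omega),
      add_right_comm, h]
    linear_combination count_succ_left i d
  · rw [edgeCount_eq_zero h3, edgeCount_eq_zero (show ¬ 3 ∣ n + 3 + d by omega), mul_zero, mul_zero]

/-- These are the coefficients not reached by multiplication by `t³`. If `n + d = 3(i + 1)` with `n
< 3`, then `d > 2i`, and the recurrence in `i` starts from zero. -/
theorem edgeCount_of_lt_three {n : ℕ} (hn : n < 3) (d : ℕ) :
    ((n + d) / 3 : ℚ) * ((n + d) / 3 + 1) *
        ((2 * ((n + d) / 3) - d) * (2 * ((n + d) / 3) - d - 1)) * edgeCount n d = 0 := by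
  by_cases h3 : 3 ∣ n + d
  · obtain ⟨i, hi⟩ := h3
    have h := cast_add_cast_of_eq hi
    rw [edgeCount_eq_count hi, h]
    rcases i with _ | i
    · simp
    · have h := count_succ_left i d
      rw [count_eq_zero (i := i) (d := d) (by omega), mul_zero] at h
      push_cast
      linear_combination h
  · rw [edgeCount_eq_zero h3, mul_zero]

theorem isDFinite_edgeSeries : IsDFinite edgeSeries := by
  -- Since `n = 3i - d`, the exponent function for `i` is `(n + d) / 3`. Raising `d` at fixed `i` is
  -- multiplication by `y / t`, whence `u = t` and `v = y`, and raising `i` at fixed `d` is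
  -- multiplication by `t³`.
  refine isDFinite_of_recurrence edgeSeries (fun m => ((m 0 : ℚ) + m 1) / 3) (fun m => (m 1 : ℚ)) ?_
    (MvPolynomial.X 0) (MvPolynomial.X 1) (MvPolynomial.X 0 ^ 3) ?_ ?_ ?_ ?_ ?_
  · intro k
    fin_cases k
    · have h : (fun m : Fin 2 →₀ ℕ => (m 0 : ℚ)) =
          (3 : ℚ) • (fun m => ((m 0 : ℚ) + m 1) / 3) - fun m => (m 1 : ℚ) := by
        ext m
        simp only [Pi.sub_apply, Pi.smul_apply, smul_eq_mul]
        ring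
      change (fun m : Fin 2 →₀ ℕ => (m 0 : ℚ)) ∈ _
      rw [h]
      exact sub_mem (Submodule.smul_mem _ _ left_mem_affineSpan) right_mem_affineSpan
    · exact right_mem_affineSpan
  · intro h
    have := congrArg (MvPolynomial.eval ![1, 0]) h
    norm_num at this
  · intro h
    have := congrArg (MvPolynomial.eval ![1, 0]) h
    norm_num at this
  · intro h
    have := congrArg (MvPolynomial.eval ![1, 0]) h
    norm_num at this
  · intro a b
    ext m
    rw [coeff_X_smul, coeff_X_smul, coeff_weight, coeff_weight, coeff_edgeSeries, coeff_edgeSeries]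
    rcases hn : m 0 with _ | n <;> rcases hd : m 1 with _ | d
    · simp
    · have h := mul_edgeCount_zero_left d
      rcases mul_eq_zero.1 h with h | h
      · simp [hn, hd, Nat.cast_eq_zero.1 h]
      · simp [hn, hd, h]
    · have h := mul_edgeCount_zero_right n
      rcases mul_eq_zero.1 h with h | h
      · simp [hn, hd, Nat.cast_eq_zero.1 h]
      · simp [hn, hd, h]
    · have h := edgeCount_succ_right n d
      simp [hn, hd]
      linear_combination ((n + (d + 1) : ℚ) / 3) ^ a * (d + 1) ^ b * h
  · intro a b
    ext m
    rw [coeff_X_pow_smul, coeff_weight, coeff_weight, coeff_edgeSeries, coeff_edgeSeries]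
    obtain ⟨d, hd⟩ : ∃ d, m 1 = d := ⟨_, rfl⟩
    rcases lt_or_ge (m 0) 3 with h3 | h3
    · rw [if_neg h3.not_ge]
      have h := edgeCount_of_lt_three h3 (m 1)
      simp only [Pi.mul_apply, Pi.pow_apply, Pi.sub_apply, Pi.add_apply,
        Pi.ofNat_apply]
      linear_combination (((m 0 : ℚ) + m 1) / 3) ^ a * (m 1 : ℚ) ^ b * h
    · obtain ⟨n, hn⟩ : ∃ n, m 0 = n + 3 := ⟨m 0 - 3, by omega⟩
      have h := edgeCount_add_three n d
      simp [hn, hd]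
      linear_combination ((n + 3 + d : ℚ) / 3) ^ a * d ^ b * h

end TreeRootedNearTriangulation

theorem mainTheorem10 :
    (∀ v d : ℕ, Finite (TreeRootedNearTriangulation.WithVertices v d)) ∧
    (∀ n d : ℕ, Finite (TreeRootedNearTriangulation.WithEdges n d)) ∧
    (∀ i d : ℕ, 1 ≤ i → d ≤ 2 * i →
      (Nat.card (TreeRootedNearTriangulation.WithVertices (i + 1) d) : ℚ) =
        (d : ℚ) / (((i : ℚ) + 1) * (4 * (i : ℚ) - (d : ℚ))) *
          ((3 * i - d).choose i : ℚ) * ((4 * i - d).choose i : ℚ)) ∧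
    (∀ i d : ℕ, 2 * i < d →
      Nat.card (TreeRootedNearTriangulation.WithVertices (i + 1) d) = 0) ∧
    Nat.card (TreeRootedNearTriangulation.WithVertices 1 0) = 1 ∧
    IsDFinite TreeRootedNearTriangulation.vertexSeries ∧
    IsDFinite TreeRootedNearTriangulation.edgeSeries := by
  refine ⟨TreeRootedNearTriangulation.finite_withVertices,
    TreeRootedNearTriangulation.finite_withEdges, TreeRootedNearTriangulation.count_eq,
    fun i d h => ?_, ?_, TreeRootedNearTriangulation.isDFinite_vertexSeries,
    TreeRootedNearTriangulation.isDFinite_edgeSeries⟩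
  · have := TreeRootedNearTriangulation.isEmpty_withVertices h
    exact Nat.card_of_isEmpty
  · obtain ⟨_⟩ := TreeRootedNearTriangulation.unique_withVertices_one
    exact Nat.card_unique
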